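/- **Semantic substitution of functional terms (polarized SILL).** *Language.* Session types have a polarity $+$ or $-$; $\Xi$ ranges over contexts of polarized type variables. The types $\Xi\vdash A$ are: positive $\mathbf 1$, ${\downarrow}A$ ($A$ negative), $\oplus\{l:A_l\}_{l\in L}$, $A\otimes B$, $\tau\wedge A$ ($A,B,A_l$ positive); negative ${\uparrow}A$ ($A$ positive), $\&\{l:A_l\}_{l\in L}$, $A\multimap B$ ($A$ positive, $B$ negative), $\tau\supset A$ ($A,B,A_l$ negative); variables $\alpha$, and $\rho\alpha.A$ with $\alpha$ and $A$ of the same polarity ($L$ finite). Functional types are $\tau\to\sigma$ and $\{a:A\leftarrow a_1:A_1,\dots,a_n:A_n\}$ with closed session types. Functional terms $\Psi\vdash M:\tau$ are variables, $\mathsf{fix}\,x.M$, $\lambda x{:}\tau.M$, $M\,N$ and quoted processes $a\leftarrow\{P\}\leftarrow\overline{a_i}$. Processes $\Psi;\Delta\vdash P::c:C$ provide a channel $c$ and use the channels in $\Delta$; they are formed by forwarding, cut, the right and left rules of $\mathbf 1,\downarrow,\uparrow,\oplus,\&,\otimes,\multimap,\wedge,\supset,\rho$ (with $\otimes R$ and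 $\multimap L$ sending a channel $b:B$ of $\Delta$, and the $\rho$ rules passing between $\rho\alpha.A$ and $[\rho\alpha.A/\alpha]A$), and by spawning $a\leftarrow\{M\}\leftarrow\overline{a_i}$ a quoted process $M:\{a:A\leftarrow\overline{a_i:A_i}\}$. *Types.* A domain is a pointed dcpo. $D_\bot$ is lifting with unit $\mathsf{up}$ and counit $\mathsf{down}$, $[D\to E]$ is the domain of continuous functions, $[D\multimap E]$ that of strict ones, and $\bigoplus$ is the coalesced sum. A session type $\Xi\vdash A$ denotes a locally continuous functor $[\![A]\!]=([\![A]\!]^-,[\![A]\!]^+)$ from $\prod_{\alpha\in\Xi}(\mathcal M\times\mathcal M)$ to $\mathcal M\times\mathcal M$, where $\mathcal M$ is the category of domains and strict continuous functions; a variable denotes a projection, and (writing $A^\pm$ for $[\![A]\!]^\pm$) $$\mathbf 1^-=\{\bot\},\ \mathbf 1^+=\{*\}_\bot;\quad ({\downarrow}A)^-=A^-,\ ({\downarrow}A)^+=A^+_\bot;\quad ({\uparrow}A)^-=A^-_\bot,\ ({\uparrow}A)^+=A^+;$$ $$(\oplus_lA_l)^-=\textstyle\prod_lA_l^-,\ (\oplus_lA_l)^+=\bigoplus_l(A_l^+)_\bot;\quad(\&_lA_l)^-=\bigoplus_l(A_l^-)_\bot,\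 (\&_lA_l)^+=\prod_lA_l^+;$$ $$(A\otimes B)^-=A^-\times B^-,\ (A\otimes B)^+=(A^+\times B^+)_\bot;\quad(A\multimap B)^-=(A^+\times B^-)_\bot,\ (A\multimap B)^+=A^-\times B^+;$$ $$(\tau\wedge A)^-=A^-,\ (\tau\wedge A)^+=([\![\tau]\!]\times A^+)_\bot;\quad(\tau\supset A)^-=([\![\tau]\!]\times A^-)_\bot,\ (\tau\supset A)^+=A^+;$$ and $[\![\rho\alpha.A]\!]$ is the canonical fixed point in $\mathcal M\times\mathcal M$ (the bilimit of the iterates from the one-point domains) of $[\![A]\!]$ in the argument $\alpha$, with isomorphisms $\mathsf{Fold}:[\![[\rho\alpha.A/\alpha]A]\!]\to[\![\rho\alpha.A]\!]$ and $\mathsf{Unfold}=\mathsf{Fold}^{-1}$. Further $[\![\tau\to\sigma]\!]=[[\![\tau]\!]\multimap[\![\sigma]\!]]$ and $[\![\{a:A\leftarrow\overline{a_i:A_i}\}]\!]=[\prod_iA_i^+\times A^-\to\prod_iA_i^-\times A^+]_\bot$. *Terms and processes.* Let $[\![\Psi]\!]=\prod_{x:\tau\in\Psi}[\![\tau]\!]$,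 and let $[\![\Delta]\!]^\pm$ be the product of the $[\![A_i]\!]^\pm$ for $a_i:A_i$ in $\Delta$. A term denotes a continuous function $[\![\Psi\vdash M:\tau]\!]:[\![\Psi]\!]\to[\![\tau]\!]$ and a process a continuous function $[\![\Psi;\Delta\vdash P::c:C]\!]:[\![\Psi]\!]\to\big[[\![\Delta]\!]^+\times[\![C]\!]^-\to[\![\Delta]\!]^-\times[\![C]\!]^+\big]$, defined by recursion on the typing derivation. Below $u\in[\![\Psi]\!]$, the symbols $\delta^\pm,a^\pm,c^\pm$ are the values on $\Delta$, on the principal channel and on the provided channel, and "where $P\mapsto(\dots)$" gives the output of $[\![P]\!]u$ on the obvious inputs; "strict in $a^\pm$" means that the whole output is $\bot$ if $a^\pm=\bot$. - Variables are projections; $[\![\mathsf{fix}\,x.M]\!]u$ is the least fixed point of $v\mapsto[\![M]\!](u,v)$; $[\![\lambda x.M]\!]u$ is $v\mapsto[\![M]\!](u,v)$ for $v\ne\bot$, and $\bot\mapsto\bot$; $[\![M N]\!]u=[\![M]\!]u([\![N]\!]u)$; quoting is $\mathsf{up}\circ[\![P]\!]$ and spawning is $\mathsf{down}\circ[\![M]\!]$.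 - Forwarding maps $(a^+,b^-)$ to $(a^-=b^-,\ b^+=a^+)$. Cutting $P$ (providing $a:A$) with $Q$ (using it) is the trace of $[\![P]\!]u\times[\![Q]\!]u$ over $A^-\times A^+$, where the trace of $f:D\times X\to E\times X$ is $d\mapsto\pi_Ef(d,x)$ with $x$ the least fixed point of $x\mapsto\pi_Xf(d,x)$. - $\mathbf 1R$ outputs $a^+=\mathsf{up}(*)$; $\mathbf 1L$ is $[\![P]\!]u$ made strict in $a^+$, with $a^-=\bot$. $\downarrow R$ and $\uparrow L$ postcompose the output on $a$ with $\mathsf{up}$; $\downarrow L$ and $\uparrow R$ precompose the input on $a$ with $\mathsf{down}$ and make the result strict in that input. - $\oplus R_k$ maps $(\delta^+,(a_l^-)_l)$ to $(\delta^-,(k,\mathsf{up}\,a_k^+))$ where $P\mapsto(\delta^-,a_k^+)$ on $(\delta^+,a_k^-)$; $\oplus L$ is strict in $a^+$ and on $a^+=(k,\mathsf{up}\,a_k^+)$ runs $P_k$ and outputs on $a$ the family with $a_k^-$ at $k$ and $\bot$ elsewhere. $\&L_k$ and $\&R$ are the same with the aspects $+$ and $-$ of $a$ interchanged. - $\otimes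 R$: $(\delta^+,b^+,(a_B^-,a_A^-))\mapsto(\delta^-,a_B^-,\mathsf{up}(b^+,a_A^+))$ where $P\mapsto(\delta^-,a_A^+)$. $\otimes L$: strict in $a^+$, and for $a^+=\mathsf{up}(a_B^+,a_A^+)$ outputs $(\delta^-,(b^-,a^-),c^+)$ where $P\mapsto(\delta^-,a^-,b^-,c^+)$. $\multimap R$: strict in $a^-$, and for $a^-=\mathsf{up}(a_B^+,a_A^-)$ outputs $(\delta^-,(b^-,a^+))$ where $P\mapsto(\delta^-,b^-,a^+)$. $\multimap L$: $(\delta^+,b^+,(a_B^-,a_A^+),c^-)\mapsto(\delta^-,a_B^-,\mathsf{up}(b^+,a_A^-),c^+)$ where $P\mapsto(\delta^-,a_A^-,c^+)$. - $\wedge R$ (and $\supset L$): $\bot$ if $v=[\![M]\!]u=\bot$; otherwise the output of $P$ with the component on $a$ replaced by $\mathsf{up}(v,a^+)$ (resp. $\mathsf{up}(v,a^-)$). $\wedge L$ (and $\supset R$): strict in $a^+$ (resp. $a^-$), and for the input $\mathsf{up}(v,\alpha)$ on $a$ equal to $[\![P]\!](u,x\mapsto v)$ with input $\alpha$ on $a$.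 - All $\rho$ rules precompose the input on $a$ with $\mathsf{Unfold}$ and postcompose the output on $a$ with $\mathsf{Fold}$. **Proposition.** Let $\Psi=x_1:\tau_1,\dots,x_n:\tau_n$ and let $\Phi\vdash M_i:\tau_i$ $(1\le i\le n)$ be functional terms. Write $[\vec M/\vec x]$ for simultaneous capture-avoiding substitution. If $\Psi\vdash N:\tau$, then $$[\![\Phi\vdash[\vec M/\vec x]N:\tau]\!]=[\![\Psi\vdash N:\tau]\!]\circ\langle[\![\Phi\vdash M_i:\tau_i]\!]\mid 1\le i\le n\rangle,$$ and if $\Psi;\Delta\vdash P::c:C$, then $$[\![\Phi;\Delta\vdash[\vec M/\vec x]P::c:C]\!]=[\![\Psi;\Delta\vdash P::c:C]\!]\circ\langle[\![\Phi\vdash M_i:\tau_i]\!]\mid 1\le i\le n\rangle.$$ -/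

import Mathlib

namespace SILL

/-! ### Pointed directed-complete partial orders -/

/-- A pointed partial order in which all non-empty directed sets have suprema is a pointed dcpo. -/
@[reducible]
noncomputable def cpoOfExists (α : Type*) [P : PartialOrder α] [B : OrderBot α]
    (h : ∀ d : Set α, d.Nonempty → DirectedOn (· ≤ ·) d → ∃ a, IsLUB d a) :
    CompletePartialOrder α := by
  classical
  exact
  { P, B with
    sSup := fun d => if hd : d.Nonempty ∧ DirectedOn (· ≤ ·) d then (h d hd.1 hd.2).choose else ⊥
    lubOfDirected := by
      intro d hd
      rcases d.eq_empty_or_nonempty with rfl | hne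
      · simp
      · rw [dif_pos ⟨hne, hd⟩]
        exact (h d hne hd).choose_spec }

theorem exists_lub {α : Type*} [CompletePartialOrder α] (d : Set α)
    (hd : DirectedOn (· ≤ ·) d) : ∃ a, IsLUB d a := ⟨_, hd.isLUB_sSup⟩

theorem directedOn_image {α β : Type*} [Preorder α] [Preorder β] {f : α → β} (hf : Monotone f)
    {d : Set α} (hd : DirectedOn (· ≤ ·) d) : DirectedOn (· ≤ ·) (f '' d) := by
  rintro _ ⟨x, hx, rfl⟩ _ ⟨y, hy, rfl⟩
  obtain ⟨z, hz, hxz, hyz⟩ := hd x hx y hy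
  exact ⟨_, ⟨z, hz, rfl⟩, hf hxz, hf hyz⟩

noncomputable instance {α β : Type*} [CompletePartialOrder α] [CompletePartialOrder β] :
    CompletePartialOrder (α × β) :=
  cpoOfExists _ fun d _ hd => by
    refine ⟨(sSup (Prod.fst '' d), sSup (Prod.snd '' d)), isLUB_prod.2 ⟨?_, ?_⟩⟩
    · exact (directedOn_image monotone_fst hd).isLUB_sSup
    · exact (directedOn_image monotone_snd hd).isLUB_sSup

noncomputable instance {ι : Type*} {α : ι → Type*} [∀ i, CompletePartialOrder (α i)] :
    CompletePartialOrder (∀ i, α i) :=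
  cpoOfExists _ fun d _ hd =>
    ⟨fun i => sSup (Function.eval i '' d), isLUB_pi.2 fun i =>
      (directedOn_image (Function.monotone_eval i) hd).isLUB_sSup⟩

/-- The lifting of a partial order with suprema of non-empty directed sets is a pointed dcpo. -/
theorem exists_lub_withBot {α : Type*} [PartialOrder α]
    (h : ∀ d : Set α, d.Nonempty → DirectedOn (· ≤ ·) d → ∃ a, IsLUB d a)
    (d : Set (WithBot α)) (hd : DirectedOn (· ≤ ·) d) : ∃ a, IsLUB d a := by
  by_cases hne : ((↑) ⁻¹' d : Set α).Nonempty
  · have hdir : DirectedOn (· ≤ ·) ((↑) ⁻¹' d : Set α) := by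
      intro x hx y hy
      obtain ⟨z, hz, hxz, hyz⟩ := hd x hx y hy
      lift z to α using (by rintro rfl; simp at hxz)
      exact ⟨z, hz, by simpa using hxz, by simpa using hyz⟩
    obtain ⟨a, ha⟩ := h _ hne hdir
    refine ⟨a, ?_, ?_⟩
    · intro x hx
      induction x with
      | bot => exact bot_le
      | coe x => exact WithBot.coe_le_coe.2 (ha.1 hx)
    · intro b hb
      obtain ⟨x, hx⟩ := hne
      have := hb hx
      lift b to α using (by rintro rfl; simp at this)
      exact WithBot.coe_le_coe.2 (ha.2 fun y hy => WithBot.coe_le_coe.1 (hb hy))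
  · refine ⟨⊥, ?_, fun _ _ => bot_le⟩
    intro x hx
    induction x with
    | bot => exact le_rfl
    | coe x => exact absurd ⟨x, hx⟩ hne

/-- The lifting `D_⊥` of a pointed dcpo. -/
noncomputable instance {α : Type*} [CompletePartialOrder α] : CompletePartialOrder (WithBot α) :=
  cpoOfExists _ fun d _ hd => exists_lub_withBot (fun d _ => exists_lub d) d hd

theorem exists_lub_sigma {ι : Type*} {α : ι → Type*} [∀ i, CompletePartialOrder (α i)]
    (d : Set (Σ i, α i)) (hne : d.Nonempty) (hd : DirectedOn (· ≤ ·) d) : ∃ a, IsLUB d a := by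
  obtain ⟨⟨i, x⟩, hx⟩ := hne
  have key : ∀ y ∈ d, ∃ z : α i, y = ⟨i, z⟩ := by
    intro y hy
    obtain ⟨z, hz, hxz, hyz⟩ := hd _ hx y hy
    cases hxz
    cases hyz
    exact ⟨_, rfl⟩
  have hdir : DirectedOn (· ≤ ·) (Sigma.mk i ⁻¹' d) := by
    intro a ha b hb
    obtain ⟨z, hz, haz, hbz⟩ := hd _ ha _ hb
    obtain ⟨z, rfl⟩ := key z hz
    exact ⟨z, hz, Sigma.mk_le_mk_iff.1 haz, Sigma.mk_le_mk_iff.1 hbz⟩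
  refine ⟨⟨i, sSup (Sigma.mk i ⁻¹' d)⟩, ?_, ?_⟩
  · intro y hy
    obtain ⟨z, rfl⟩ := key y hy
    exact Sigma.mk_le_mk_iff.2 (hdir.isLUB_sSup.1 hy)
  · rintro ⟨j, b⟩ hb
    have h1 := hb hx
    cases h1
    exact Sigma.mk_le_mk_iff.2 (hdir.isLUB_sSup.2 fun y hy => Sigma.mk_le_mk_iff.1 (hb hy))

/-- The lifted disjoint union `(⨄ i, D i)_⊥`, which is the coalesced sum `⨁ i, (D i)_⊥`: its
elements are `⊥` and the pairs of an index `i` and an element of `D i`. -/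
noncomputable instance {ι : Type*} {α : ι → Type*} [∀ i, CompletePartialOrder (α i)] :
    CompletePartialOrder (WithBot (Σ i, α i)) :=
  cpoOfExists _ fun d _ hd => exists_lub_withBot exists_lub_sigma d hd

/-- A subset containing `⊥` and closed under directed suprema is a pointed dcpo. -/
@[reducible]
noncomputable def cpoSubtype {α : Type*} [CompletePartialOrder α] (p : α → Prop) (hb : p ⊥)
    (hs : ∀ (d : Set α) (a : α), d.Nonempty → DirectedOn (· ≤ ·) d → IsLUB d a →
      (∀ x ∈ d, p x) → p a) : CompletePartialOrder {x // p x} :=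
  letI : OrderBot {x // p x} := { bot := ⟨⊥, hb⟩, bot_le := fun _ => Subtype.mk_le_mk.2 bot_le }
  cpoOfExists _ fun d hne hd => by
    have hd' := directedOn_image (Subtype.mono_coe p) hd
    refine ⟨⟨sSup (Subtype.val '' d), hs _ _ (hne.image _) hd' hd'.isLUB_sSup ?_⟩, ?_, ?_⟩
    · rintro _ ⟨x, _, rfl⟩
      exact x.2
    · intro x hx
      exact hd'.isLUB_sSup.1 ⟨x, hx, rfl⟩
    · intro b hb
      refine hd'.isLUB_sSup.2 ?_
      rintro _ ⟨x, hx, rfl⟩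
      exact hb hx

/-! ### Continuous and strict continuous functions -/

/-- Scott-continuous functions between pointed dcpos. -/
@[ext]
structure CMap (α β : Type*) [CompletePartialOrder α] [CompletePartialOrder β] where
  toFun : α → β
  cont : ScottContinuous toFun

section CMap
variable {α β γ δ : Type*} [CompletePartialOrder α] [CompletePartialOrder β]
  [CompletePartialOrder γ] [CompletePartialOrder δ]

instance : FunLike (CMap α β) α β where
  coe := CMap.toFun
  coe_injective := fun _ _ h => CMap.ext h

@[simp] theorem CMap.mk_apply (f : α → β) (hf : ScottContinuous f) (x : α) :
    (CMap.mk f hf) x = f x := rfl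

theorem CMap.ext' {f g : CMap α β} (h : ∀ x, f x = g x) : f = g := DFunLike.ext _ _ h

/-- Continuous functions are ordered pointwise. -/
instance : PartialOrder (CMap α β) := PartialOrder.lift (fun f => (f : α → β)) DFunLike.coe_injective

theorem CMap.le_def {f g : CMap α β} : f ≤ g ↔ ∀ x, f x ≤ g x := Iff.rfl

instance : OrderBot (CMap α β) where
  bot := ⟨fun _ => ⊥, ScottContinuous.const ⊥⟩
  bot_le _ _ := bot_le

@[simp] theorem CMap.bot_apply (x : α) : (⊥ : CMap α β) x = ⊥ := rfl

theorem CMap.eval_mono (x : α) : Monotone (fun f : CMap α β => f x) := fun _ _ h => h x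

theorem cont_of_isLUB {α β : Type*} [Preorder α] [Preorder β] {ι : Type*} (s : Set ι)
    (F : ι → α → β) (hF : ∀ i ∈ s, ScottContinuous (F i)) (f : α → β)
    (hf : ∀ x, IsLUB ((fun i => F i x) '' s) (f x)) : ScottContinuous f := by
  intro d hne hd a ha
  refine ⟨?_, ?_⟩
  · rintro _ ⟨x, hx, rfl⟩
    refine (hf x).2 ?_
    rintro _ ⟨i, hi, rfl⟩
    exact ((hF i hi).monotone (ha.1 hx)).trans ((hf a).1 ⟨i, hi, rfl⟩)
  · intro b hb
    refine (hf a).2 ?_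
    rintro _ ⟨i, hi, rfl⟩
    refine (hF i hi hne hd ha).2 ?_
    rintro _ ⟨x, hx, rfl⟩
    exact ((hf x).1 ⟨i, hi, rfl⟩).trans (hb ⟨x, hx, rfl⟩)

theorem CMap.exists_pointwise_lub (d : Set (CMap α β)) (hd : DirectedOn (· ≤ ·) d) :
    ∃ f : CMap α β, IsLUB d f ∧ ∀ x, IsLUB ((fun g : CMap α β => g x) '' d) (f x) := by
  have h : ∀ x, IsLUB ((fun g : CMap α β => g x) '' d) (sSup ((fun g : CMap α β => g x) '' d)) :=
    fun x => (directedOn_image (CMap.eval_mono x) hd).isLUB_sSup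
  refine ⟨⟨_, cont_of_isLUB d (fun g => g) (fun g _ => g.cont) _ h⟩, ⟨?_, ?_⟩, h⟩
  · intro g hg x
    exact (h x).1 ⟨g, hg, rfl⟩
  · intro g hg x
    refine (h x).2 ?_
    rintro _ ⟨k, hk, rfl⟩
    exact hg hk x

noncomputable instance : CompletePartialOrder (CMap α β) :=
  cpoOfExists _ fun d _ hd => let ⟨f, hf, _⟩ := CMap.exists_pointwise_lub d hd; ⟨f, hf⟩

theorem CMap.isLUB_apply {d : Set (CMap α β)} (hd : DirectedOn (· ≤ ·) d) {f : CMap α β}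
    (hf : IsLUB d f) (x : α) : IsLUB ((fun g : CMap α β => g x) '' d) (f x) := by
  obtain ⟨g, hg, h⟩ := CMap.exists_pointwise_lub d hd
  rw [hf.unique hg]
  exact h x

theorem CMap.cont_eval : ScottContinuous (fun p : CMap α β × α => p.1 p.2) :=
  ScottContinuous.fromProd (fun f => f.cont)
    (fun x _ _ hd _ hf => CMap.isLUB_apply hd hf x)

@[fun_prop]
theorem CMap.cont_apply {α β γ : Type*} [CompletePartialOrder α] [CompletePartialOrder β]
    [Preorder γ] {f : γ → CMap α β} {g : γ → α} (hf : ScottContinuous f)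
    (hg : ScottContinuous g) : ScottContinuous (fun z => f z (g z)) :=
  ScottContinuous.comp (hf.prodMk hg) CMap.cont_eval

/-- Currying. -/
theorem cont_lam {γ : Type*} [Preorder γ] {F : γ → α → β} (h : ∀ z, ScottContinuous (F z))
    (hF : ∀ x, ScottContinuous (fun z => F z x)) :
    ScottContinuous (fun z => CMap.mk (F z) (h z)) := by
  intro d hne hd a ha
  refine ⟨?_, ?_⟩
  · rintro _ ⟨z, hz, rfl⟩ x
    exact (hF x).monotone (ha.1 hz)
  · intro g hg x
    refine (hF x hne hd ha).2 ?_
    rintro _ ⟨z, hz, rfl⟩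
    exact hg ⟨z, hz, rfl⟩ x

/-- The curried form of a jointly continuous function. -/
def CMap.lam (F : α → β → γ) (h : ScottContinuous (fun p : α × β => F p.1 p.2)) :
    CMap α (CMap β γ) where
  toFun a := ⟨fun b => F a b,
    ScottContinuous.comp (f := fun b => (a, b)) (g := fun p : α × β => F p.1 p.2)
      (by fun_prop) h⟩
  cont := cont_lam _ fun b =>
    ScottContinuous.comp (f := fun a => (a, b)) (g := fun p : α × β => F p.1 p.2)
      (by fun_prop) h

@[simp] theorem CMap.lam_apply (F : α → β → γ)
    (h : ScottContinuous (fun p : α × β => F p.1 p.2)) (a : α) (b : β) :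
    CMap.lam F h a b = F a b := rfl

/-- Composition `g ∘ f`. -/
def CMap.comp (g : CMap β γ) (f : CMap α β) : CMap α γ :=
  ⟨fun x => g (f x), by have := f.cont; have := g.cont; exact ScottContinuous.fun_comp ‹_› ‹_›⟩

@[simp] theorem CMap.comp_apply (g : CMap β γ) (f : CMap α β) (x : α) : g.comp f x = g (f x) := rfl

@[fun_prop]
theorem CMap.cont_coe (f : CMap α β) : ScottContinuous (fun x => f x) := f.cont

/-- Strict continuous functions. -/
def SMap (α β : Type*) [CompletePartialOrder α] [CompletePartialOrder β] :=
  {f : CMap α β // f ⊥ = ⊥}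

instance : FunLike (SMap α β) α β where
  coe f := f.1
  coe_injective := fun _ _ h => Subtype.ext (DFunLike.coe_injective h)

theorem SMap.ext {f g : SMap α β} (h : ∀ x, f x = g x) : f = g := DFunLike.ext _ _ h

/-- Strict continuous functions are ordered pointwise and form a pointed dcpo. -/
noncomputable instance : CompletePartialOrder (SMap α β) :=
  cpoSubtype (fun f : CMap α β => f ⊥ = ⊥) rfl fun d f _ hd hf h => by
    refine le_bot_iff.1 ((CMap.isLUB_apply hd hf ⊥).2 ?_)
    rintro _ ⟨g, hg, rfl⟩
    exact (h g hg).le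

theorem SMap.le_def {f g : SMap α β} : f ≤ g ↔ ∀ x, f x ≤ g x := Iff.rfl

@[simp] theorem SMap.map_bot (f : SMap α β) : f ⊥ = ⊥ := f.2

@[simp] theorem SMap.bot_apply (x : α) : (⊥ : SMap α β) x = ⊥ := rfl

@[simp] theorem SMap.mk_apply (f : α → β) (hf : ScottContinuous f)
    (h : (CMap.mk f hf : CMap α β) ⊥ = ⊥) (x : α) : (show SMap α β from ⟨⟨f, hf⟩, h⟩) x = f x := rfl

theorem cont_subtype_val {α : Type*} [CompletePartialOrder α] (p : α → Prop)
    (hs : ∀ (d : Set α) (a : α), d.Nonempty → DirectedOn (· ≤ ·) d → IsLUB d a →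
      (∀ x ∈ d, p x) → p a) : ScottContinuous (Subtype.val : {x // p x} → α) := by
  intro d hne hd a ha
  have hd' := directedOn_image (Subtype.mono_coe p) hd
  have hp : p (sSup (Subtype.val '' d)) := by
    refine hs _ _ (hne.image _) hd' hd'.isLUB_sSup ?_
    rintro _ ⟨x, _, rfl⟩
    exact x.2
  have h1 : IsLUB d ⟨sSup (Subtype.val '' d), hp⟩ := by
    refine ⟨fun x hx => hd'.isLUB_sSup.1 ⟨x, hx, rfl⟩, fun b hb => hd'.isLUB_sSup.2 ?_⟩
    rintro _ ⟨x, hx, rfl⟩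
    exact hb hx
  rw [ha.unique h1]
  exact hd'.isLUB_sSup

theorem cont_subtype_mk {α β : Type*} [Preorder α] [Preorder β] {p : β → Prop} {f : α → β}
    (hf : ScottContinuous f) (h : ∀ x, p (f x)) :
    ScottContinuous (fun x => (⟨f x, h x⟩ : {y // p y})) := by
  intro d hne hd a ha
  refine ⟨?_, ?_⟩
  · rintro _ ⟨x, hx, rfl⟩
    exact hf.monotone (ha.1 hx)
  · rintro b hb
    refine (hf hne hd ha).2 ?_
    rintro _ ⟨x, hx, rfl⟩
    exact hb ⟨x, hx, rfl⟩

theorem SMap.cont_val : ScottContinuous (Subtype.val : SMap α β → CMap α β) :=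
  cont_subtype_val _ fun d f _ hd hf h => by
    refine le_bot_iff.1 ((CMap.isLUB_apply hd hf ⊥).2 ?_)
    rintro _ ⟨g, hg, rfl⟩
    exact (h g hg).le

@[fun_prop]
theorem SMap.cont_apply {α β γ : Type*} [CompletePartialOrder α] [CompletePartialOrder β]
    [Preorder γ] {f : γ → SMap α β} {g : γ → α} (hf : ScottContinuous f)
    (hg : ScottContinuous g) : ScottContinuous (fun z => f z (g z)) :=
  CMap.cont_apply (ScottContinuous.fun_comp hf SMap.cont_val) hg

@[fun_prop]
theorem SMap.cont_coe (f : SMap α β) : ScottContinuous (fun x => f x) := f.1.cont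

/-- To check that a map into strict functions is continuous, it suffices to check it pointwise. -/
theorem SMap.cont_of_apply {γ : Type*} [Preorder γ] {f : γ → SMap α β}
    (h : ∀ x, ScottContinuous (fun z => f z x)) : ScottContinuous f :=
  cont_subtype_mk (cont_lam (fun z => (f z).1.cont) h) fun z => (f z).2

def SMap.id (α : Type*) [CompletePartialOrder α] : SMap α α := ⟨⟨fun x => x, by fun_prop⟩, rfl⟩

/-- Composition of strict functions, in diagrammatic order. -/
def SMap.comp (f : SMap α β) (g : SMap β γ) : SMap α γ :=
  ⟨⟨fun x => g (f x), by fun_prop⟩, by simp⟩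

@[simp] theorem SMap.id_apply (x : α) : SMap.id α x = x := rfl

@[simp] theorem SMap.comp_apply (f : SMap α β) (g : SMap β γ) (x : α) :
    f.comp g x = g (f x) := rfl

theorem cont_orderIso {α β : Type*} [Preorder α] [Preorder β] (e : α ≃o β) :
    ScottContinuous (fun x => e x) := by
  intro d _ _ a ha
  exact (OrderIso.isLUB_image' e).2 ha

@[fun_prop]
theorem cont_orderIso_apply {α β γ : Type*} [Preorder α] [Preorder β] [Preorder γ] (e : α ≃o β)
    {f : γ → α} (hf : ScottContinuous f) : ScottContinuous (fun z => e (f z)) :=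
  ScottContinuous.fun_comp hf (cont_orderIso e)

@[fun_prop]
theorem cont_pi {γ ι : Type*} {D : ι → Type*} [Preorder γ] [∀ i, Preorder (D i)]
    {f : γ → ∀ i, D i} (hf : ∀ i, ScottContinuous (fun z => f z i)) : ScottContinuous f := by
  intro d hne hd a ha
  rw [isLUB_pi]
  intro i
  rw [← Set.image_comp]
  exact hf i hne hd ha

@[fun_prop]
theorem cont_eval {ι : Type*} {D : ι → Type*} [∀ i, Preorder (D i)] (i : ι) :
    ScottContinuous (fun f : ∀ i, D i => f i) := by
  intro d _ _ a ha
  exact (isLUB_pi.1 ha) i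

/-! ### Lifting, strictness and case distinction -/

/-- The unit `up : D → D_⊥`. -/
def up {α : Type*} (x : α) : WithBot α := x

/-- The counit `down : D_⊥ → D`. -/
def down (x : WithBot α) : α := x.recBotCoe ⊥ (fun a => a)

@[simp] theorem down_up (x : α) : down (up x) = x := rfl

@[simp] theorem down_bot : down (⊥ : WithBot α) = ⊥ := rfl

@[fun_prop]
theorem cont_up {α : Type*} [Preorder α] : ScottContinuous (up : α → WithBot α) := by
  intro d hne _ a ha
  refine ⟨?_, ?_⟩
  · rintro _ ⟨x, hx, rfl⟩
    exact WithBot.coe_le_coe.2 (ha.1 hx)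
  · intro b hb
    obtain ⟨x, hx⟩ := hne
    have := hb ⟨x, hx, rfl⟩
    lift b to α using (by rintro rfl; simp [up] at this)
    exact WithBot.coe_le_coe.2 (ha.2 fun y hy => WithBot.coe_le_coe.1 (hb ⟨y, hy, rfl⟩))

/-- A function out of a lifted partial order that is monotone and preserves `⊥` is continuous if it
is continuous on the proper elements. -/
theorem cont_withBot {α β : Type*} [PartialOrder α] [PartialOrder β] [OrderBot β] {f : WithBot α → β}
    (hb : f ⊥ = ⊥) (hf : ScottContinuous (fun a : α => f a)) : ScottContinuous f := by
  have hmono : Monotone f := by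
    intro x y hxy
    induction x with
    | bot => simp [hb]
    | coe x =>
      lift y to α using (by rintro rfl; simp at hxy)
      exact hf.monotone (WithBot.coe_le_coe.1 hxy)
  intro d hne hd a ha
  refine ⟨?_, ?_⟩
  · rintro _ ⟨x, hx, rfl⟩
    exact hmono (ha.1 hx)
  intro b hb'
  by_cases hp : ((↑) ⁻¹' d : Set α).Nonempty
  · have hdir : DirectedOn (· ≤ ·) ((↑) ⁻¹' d : Set α) := by
      intro x hx y hy
      obtain ⟨z, hz, hxz, hyz⟩ := hd x hx y hy
      lift z to α using (by rintro rfl; simp at hxz)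
      exact ⟨z, hz, by simpa using hxz, by simpa using hyz⟩
    obtain ⟨x₀, hx₀⟩ := hp
    have h0 := ha.1 hx₀
    lift a to α using (by rintro rfl; simp at h0)
    have hlub : IsLUB ((↑) ⁻¹' d : Set α) a := by
      refine ⟨fun x hx => WithBot.coe_le_coe.1 (ha.1 hx), fun c hc => ?_⟩
      refine WithBot.coe_le_coe.1 (ha.2 ?_)
      intro x hx
      induction x with
      | bot => exact bot_le
      | coe x => exact WithBot.coe_le_coe.2 (hc hx)
    refine (hf ⟨x₀, hx₀⟩ hdir hlub).2 ?_
    rintro _ ⟨x, hx, rfl⟩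
    exact hb' ⟨x, hx, rfl⟩
  · have : a = ⊥ := by
      refine eq_bot_iff.2 (ha.2 (?_ : (⊥ : WithBot α) ∈ upperBounds d))
      intro x hx
      induction x with
      | bot => exact le_rfl
      | coe x => exact absurd ⟨x, hx⟩ hp
    rw [this, hb]
    exact bot_le

theorem cont_down : ScottContinuous (down : WithBot α → α) :=
  cont_withBot rfl (ScottContinuous.id (α := α))

@[fun_prop]
theorem cont_down' {γ : Type*} [Preorder γ] {f : γ → WithBot α} (hf : ScottContinuous f) :
    ScottContinuous (fun z => down (f z)) := ScottContinuous.fun_comp hf cont_down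

open Classical in
/-- `guard v y` is `y` if `v ≠ ⊥`, and `⊥` otherwise: it makes `y` strict in `v`. -/
noncomputable def guard (v : α) (y : β) : β := if v = ⊥ then ⊥ else y

@[simp] theorem guard_bot (y : β) : guard (⊥ : α) y = ⊥ := if_pos rfl

theorem guard_of_ne {v : α} (h : v ≠ ⊥) (y : β) : guard v y = y := if_neg h

@[simp] theorem guard_bot_right (v : α) : guard v (⊥ : β) = ⊥ := by
  by_cases h : v = ⊥
  · rw [h, guard_bot]
  · rw [guard_of_ne h]

theorem cont_guard : ScottContinuous (fun p : α × β => guard p.1 p.2) := by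
  refine ScottContinuous.fromProd (fun v => ?_) (fun y => ?_)
  · by_cases h : v = ⊥
    · simp only [h, guard_bot]
      exact ScottContinuous.const ⊥
    · simp only [guard_of_ne h]
      exact ScottContinuous.id
  · intro d hne hd a ha
    dsimp only
    refine ⟨?_, ?_⟩
    · rintro _ ⟨x, hx, rfl⟩
      by_cases h : x = ⊥
      · simp [h]
      · have h' : a ≠ ⊥ := fun h' => h (le_bot_iff.1 (h' ▸ ha.1 hx))
        change guard x y ≤ guard a y
        rw [guard_of_ne h, guard_of_ne h']
    · intro b hb
      by_cases h : a = ⊥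
      · simp [h]
      · obtain ⟨x, hx, hx'⟩ : ∃ x ∈ d, x ≠ ⊥ := by
          by_contra hcon
          push Not at hcon
          exact h (le_bot_iff.1 (ha.2 fun x hx => (hcon x hx).le))
        rw [guard_of_ne h]
        have h2 : guard x y ≤ b := hb ⟨x, hx, rfl⟩
        rwa [guard_of_ne hx'] at h2

@[fun_prop]
theorem cont_guard' {γ : Type*} [Preorder γ] {f : γ → α} {g : γ → β} (hf : ScottContinuous f)
    (hg : ScottContinuous g) : ScottContinuous (fun z => guard (f z) (g z)) :=
  ScottContinuous.fun_comp (hf.prodMk hg) cont_guard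

/-- Case distinction on a lifted disjoint union, strict in the scrutinee. -/
def caseOf {ι : Type*} {D : ι → Type*} (s : WithBot (Σ i, D i)) (k : ∀ i, D i → β) : β :=
  s.recBotCoe ⊥ (fun a => k a.1 a.2)

theorem cont_sigma {ι β : Type*} {D : ι → Type*} [∀ i, CompletePartialOrder (D i)]
    [Preorder β] {f : (Σ i, D i) → β} (hf : ∀ i, ScottContinuous (fun x => f ⟨i, x⟩)) :
    ScottContinuous f := by
  have hmono : Monotone f := by
    rintro ⟨i, x⟩ ⟨j, y⟩ h
    cases h with
    | fiber _ _ _ h => exact (hf i).monotone h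
  rintro d ⟨⟨i, x⟩, hx⟩ hd a ha
  refine ⟨?_, ?_⟩
  · rintro _ ⟨x, hx, rfl⟩
    exact hmono (ha.1 hx)
  intro b hb
  have key : ∀ y ∈ d, ∃ z : D i, y = ⟨i, z⟩ := by
    intro y hy
    obtain ⟨z, hz, hxz, hyz⟩ := hd _ hx y hy
    cases hxz
    cases hyz
    exact ⟨_, rfl⟩
  obtain ⟨a, rfl⟩ : ∃ a' : D i, a = ⟨i, a'⟩ := by
    have := ha.1 hx
    cases this
    exact ⟨_, rfl⟩
  have hdir : DirectedOn (· ≤ ·) (Sigma.mk i ⁻¹' d) := by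
    intro a ha b hb
    obtain ⟨z, hz, haz, hbz⟩ := hd _ ha _ hb
    obtain ⟨z, rfl⟩ := key z hz
    exact ⟨z, hz, Sigma.mk_le_mk_iff.1 haz, Sigma.mk_le_mk_iff.1 hbz⟩
  have hlub : IsLUB (Sigma.mk i ⁻¹' d) a := by
    refine ⟨fun y hy => Sigma.mk_le_mk_iff.1 (ha.1 hy), fun c hc => ?_⟩
    refine Sigma.mk_le_mk_iff.1 (ha.2 (?_ : (⟨i, c⟩ : Σ i, D i) ∈ upperBounds d))
    intro y hy
    obtain ⟨z, rfl⟩ := key y hy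
    exact Sigma.mk_le_mk_iff.2 (hc hy)
  refine (hf i ⟨x, hx⟩ hdir hlub).2 ?_
  rintro _ ⟨y, hy, rfl⟩
  exact hb ⟨_, hy, rfl⟩

theorem cont_sigma_mk {ι : Type*} {D : ι → Type*} [∀ i, CompletePartialOrder (D i)] (i : ι) :
    ScottContinuous (Sigma.mk i : D i → Σ i, D i) := by
  rintro d ⟨x, hx⟩ _ a ha
  refine ⟨?_, ?_⟩
  · rintro _ ⟨y, hy, rfl⟩
    exact Sigma.mk_le_mk_iff.2 (ha.1 hy)
  · rintro ⟨j, b⟩ hb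
    have := hb ⟨x, hx, rfl⟩
    cases this
    exact Sigma.mk_le_mk_iff.2 (ha.2 fun y hy => Sigma.mk_le_mk_iff.1 (hb ⟨y, hy, rfl⟩))

/-- The element `(k, up x)` of a coalesced sum of liftings. -/
def inj {ι : Type*} {D : ι → Type*} (k : ι) (x : D k) : WithBot (Σ i, D i) := up ⟨k, x⟩

@[fun_prop]
theorem cont_inj {ι : Type*} {D : ι → Type*} [∀ i, CompletePartialOrder (D i)] {γ : Type*}
    [Preorder γ] (k : ι) {f : γ → D k} (hf : ScottContinuous f) :
    ScottContinuous (fun z => inj k (f z)) := by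
  have h : ScottContinuous (fun z => (⟨k, f z⟩ : Σ i, D i)) :=
    ScottContinuous.fun_comp hf (cont_sigma_mk k)
  exact ScottContinuous.fun_comp (g := up) h cont_up

@[fun_prop]
theorem cont_caseOf {ι : Type*} {D : ι → Type*} [∀ i, CompletePartialOrder (D i)] {γ : Type*}
    [Preorder γ] {s : γ → WithBot (Σ i, D i)} {k : γ → ∀ i, D i → β} (hs : ScottContinuous s)
    (hk : ∀ i, ScottContinuous (fun p : γ × D i => k p.1 i p.2)) :
    ScottContinuous (fun z => caseOf (s z) (k z)) := by
  have h : ScottContinuous (fun p : γ × WithBot (Σ i, D i) => caseOf p.2 (k p.1)) := by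
    refine ScottContinuous.fromProd (fun z => ?_) (fun x => ?_)
    · refine cont_withBot rfl (cont_sigma fun i => ?_)
      exact ScottContinuous.fun_comp (f := fun x : D i => (z, x))
        (g := fun p : γ × D i => k p.1 i p.2) (by fun_prop) (hk i)
    · induction x with
      | bot => exact ScottContinuous.const ⊥
      | coe x =>
        exact ScottContinuous.fun_comp (f := fun z => (z, x.2))
          (g := fun p : γ × D x.1 => k p.1 x.1 p.2) (by fun_prop) (hk x.1)
  exact ScottContinuous.fun_comp (f := fun z => (z, s z)) (by fun_prop) h

open Classical in
/-- The family with component `x` at `k` and `⊥` elsewhere. -/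
noncomputable def single {ι : Type*} {D : ι → Type*} [∀ i, CompletePartialOrder (D i)] (k : ι)
    (x : D k) : ∀ i, D i := Function.update ⊥ k x

@[fun_prop]
theorem cont_single {γ ι : Type*} {D : ι → Type*} [∀ i, CompletePartialOrder (D i)] [Preorder γ]
    (k : ι) {f : γ → D k} (hf : ScottContinuous f) :
    ScottContinuous (fun z => single (D := D) k (f z)) := by
  refine cont_pi fun i => ?_
  by_cases h : i = k
  · subst h
    simp [single, hf]
  · simp [single, h]

/-- The action of lifting on morphisms: `f_⊥ ⊥ = ⊥` and `f_⊥ (up d) = up (f d)`. -/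
def SMap.lift (f : SMap α β) : SMap (WithBot α) (WithBot β) :=
  ⟨⟨WithBot.map f, cont_withBot rfl
    (ScottContinuous.fun_comp (f := fun x => f x) (g := up) (by fun_prop) cont_up)⟩, rfl⟩

/-- The action of coalesced sums of liftings on morphisms. -/
def SMap.liftSum {ι : Type*} {D E : ι → Type*} [∀ i, CompletePartialOrder (D i)]
    [∀ i, CompletePartialOrder (E i)] (f : ∀ i, SMap (D i) (E i)) :
    SMap (WithBot (Σ i, D i)) (WithBot (Σ i, E i)) :=
  ⟨⟨WithBot.map fun x => ⟨x.1, f x.1 x.2⟩, cont_withBot rfl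
    (ScottContinuous.fun_comp (f := fun x : Σ i, D i => (⟨x.1, f x.1 x.2⟩ : Σ i, E i)) (g := up)
      (cont_sigma fun i => ScottContinuous.fun_comp (f := fun x => f i x) (g := Sigma.mk i)
        (by fun_prop) (cont_sigma_mk i))
      cont_up)⟩, rfl⟩

/-- The strict function that agrees with `f` except at `⊥`. -/
noncomputable def strictfn (f : CMap α β) : SMap α β :=
  ⟨⟨fun v => guard v (f v), by fun_prop⟩, by simp⟩

@[simp] theorem strictfn_apply (f : CMap α β) (v : α) : strictfn f v = guard v (f v) := rfl

@[fun_prop]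
theorem cont_strictfn : ScottContinuous (strictfn : CMap α β → SMap α β) :=
  SMap.cont_of_apply fun x => by
    simp only [strictfn_apply]
    fun_prop

/-! ### Fixed points and the trace -/

theorem cont_iterate (n : ℕ) : ScottContinuous (fun f : CMap α α => (fun x => f x)^[n] ⊥) := by
  induction n with
  | zero => exact ScottContinuous.const ⊥
  | succ n ih =>
    simp only [Function.iterate_succ_apply']
    exact CMap.cont_apply ScottContinuous.id ih

theorem iterate_mono (f : CMap α α) : Monotone (fun n => (fun x => f x)^[n] (⊥ : α)) := by
  refine monotone_nat_of_le_succ fun n => ?_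
  induction n with
  | zero => exact bot_le
  | succ n ih =>
    simp only [Function.iterate_succ_apply'] at ih ⊢
    exact f.cont.monotone ih

/-- The least fixed point `⨆ n, f^n ⊥` of a continuous function. -/
noncomputable def fix (f : CMap α α) : α := ⨆ n : ℕ, (fun x => f x)^[n] ⊥

theorem isLUB_fix (f : CMap α α) :
    IsLUB ((fun n => (fun x => f x)^[n] (⊥ : α)) '' Set.univ) (fix f) := by
  rw [Set.image_univ]
  exact (iterate_mono f).directed_le.directedOn_range.isLUB_sSup

theorem cont_fix : ScottContinuous (fix : CMap α α → α) :=
  cont_of_isLUB Set.univ (fun n (f : CMap α α) => (fun x => f x)^[n] (⊥ : α))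
    (fun n _ => cont_iterate n) fix isLUB_fix

@[fun_prop]
theorem cont_fix' {γ : Type*} [Preorder γ] {f : γ → CMap α α} (hf : ScottContinuous f) :
    ScottContinuous (fun z => fix (f z)) := ScottContinuous.fun_comp hf cont_fix

/-- The parametrized fixed point `a ↦ fix (x ↦ f (a, x))`. -/
noncomputable def sfix (f : CMap (α × β) β) : CMap α β where
  toFun a := fix (CMap.lam (fun a x => f (a, x)) (by fun_prop) a)
  cont := by fun_prop

/-- The trace `a ↦ π_B (f (a, x))`, where `x` is the least fixed point of `x ↦ π_X (f (a, x))`. -/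
noncomputable def trace (f : CMap (α × γ) (β × γ)) : CMap α β where
  toFun a := (f (a, sfix ⟨fun p => (f p).2, by fun_prop⟩ a)).1
  cont := by fun_prop

theorem cont_sfix : ScottContinuous (sfix : CMap (α × β) β → CMap α β) := by
  refine cont_lam _ fun a => cont_fix' (cont_lam _ fun x => ?_)
  fun_prop

theorem cont_trace : ScottContinuous (trace : CMap (α × γ) (β × γ) → CMap α β) := by
  refine cont_lam _ fun a => ?_
  have h : ScottContinuous (fun f : CMap (α × γ) (β × γ) =>
      (⟨fun p => (f p).2, by fun_prop⟩ : CMap (α × γ) γ)) := cont_lam _ fun x => by fun_prop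
  have h' := ScottContinuous.fun_comp h cont_sfix
  fun_prop

end CMap

/-! ### Categories of domains and locally continuous functors -/

/-- Pointed dcpos. -/
structure Dom : Type 1 where
  carrier : Type
  [cpo : CompletePartialOrder carrier]

instance : CoeSort Dom Type := ⟨Dom.carrier⟩

noncomputable instance (D : Dom) : CompletePartialOrder D := D.cpo

/-- The two polarities. They also index the two aspects of a session type. -/
inductive Pol
  | neg
  | pos

/-- The pair with negative component `n` and positive component `p`. -/
def Pol.pair {α : Pol → Type*} (n : α .neg) (p : α .pos) : ∀ q, α q
  | .neg => n
  | .pos => p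

namespace Dom

noncomputable abbrev prod (D E : Dom) : Dom := ⟨D × E⟩

noncomputable abbrev pi {ι : Type} (D : ι → Dom) : Dom := ⟨∀ i, D i⟩

noncomputable abbrev unit : Dom := ⟨PUnit⟩

noncomputable abbrev lift (D : Dom) : Dom := ⟨WithBot D⟩

/-- The coalesced sum `⨁ i, (D i)_⊥`. -/
noncomputable abbrev liftSum {ι : Type} (D : ι → Dom) : Dom := ⟨WithBot (Σ i, D i)⟩

/-- The domain of continuous functions. -/
noncomputable abbrev fn (D E : Dom) : Dom := ⟨CMap D E⟩

/-- The domain of strict continuous functions. -/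
noncomputable abbrev sfn (D E : Dom) : Dom := ⟨SMap D E⟩

end Dom

/-- Categories enriched over pointed dcpos; `comp` is composition in diagrammatic order. -/
structure OCat where
  Obj : Type 1
  Hom : Obj → Obj → Type
  [cpo : ∀ X Y, CompletePartialOrder (Hom X Y)]
  id : ∀ X, Hom X X
  comp : ∀ {X Y Z}, Hom X Y → Hom Y Z → Hom X Z
  id_comp : ∀ {X Y} (f : Hom X Y), comp (id X) f = f
  comp_id : ∀ {X Y} (f : Hom X Y), comp f (id Y) = f
  assoc : ∀ {W X Y Z} (f : Hom W X) (g : Hom X Y) (h : Hom Y Z),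
    comp (comp f g) h = comp f (comp g h)
  comp_cont : ∀ X Y Z, ScottContinuous (fun p : Hom X Y × Hom Y Z => comp p.1 p.2)

noncomputable instance (C : OCat) (X Y : C.Obj) : CompletePartialOrder (C.Hom X Y) := C.cpo X Y

namespace OCat

/-- The category `M` of pointed dcpos and strict continuous functions. -/
noncomputable abbrev M : OCat where
  Obj := Dom
  Hom D E := SMap D E
  id D := SMap.id D
  comp f g := f.comp g
  id_comp _ := rfl
  comp_id _ := rfl
  assoc _ _ _ := rfl
  comp_cont _ _ _ := SMap.cont_of_apply fun x => by
    change ScottContinuous (fun z : SMap _ _ × SMap _ _ => z.2 (z.1 x))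
    fun_prop

/-- The category `M × M`, in which the two components are indexed by the aspects. -/
noncomputable abbrev M2 : OCat where
  Obj := Pol → Dom
  Hom D E := ∀ q, SMap (D q) (E q)
  id D q := SMap.id (D q)
  comp f g q := (f q).comp (g q)
  id_comp _ := rfl
  comp_id _ := rfl
  assoc _ _ _ := rfl
  comp_cont D E F := cont_pi fun q => SMap.cont_of_apply fun x => by
    change ScottContinuous (fun z : (∀ q, SMap (D q) (E q)) × (∀ q, SMap (E q) (F q)) =>
      z.2 q (z.1 q x))
    fun_prop

/-- The terminal category. -/
noncomputable abbrev unit : OCat where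
  Obj := PUnit
  Hom _ _ := PUnit
  id _ := ⟨⟩
  comp _ _ := ⟨⟩
  id_comp _ := rfl
  comp_id _ := rfl
  assoc _ _ _ := rfl
  comp_cont _ _ _ := ScottContinuous.const _

/-- The product of two categories. -/
noncomputable abbrev prod (C D : OCat) : OCat where
  Obj := C.Obj × D.Obj
  Hom X Y := C.Hom X.1 Y.1 × D.Hom X.2 Y.2
  id X := (C.id X.1, D.id X.2)
  comp f g := (C.comp f.1 g.1, D.comp f.2 g.2)
  id_comp f := by simp [C.id_comp, D.id_comp]
  comp_id f := by simp [C.comp_id, D.comp_id]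
  assoc f g h := by simp [C.assoc, D.assoc]
  comp_cont _ _ _ := ScottContinuous.prodMk
    (ScottContinuous.fun_comp
      (f := fun p : (_ × _) × (_ × _) => (p.1.1, p.2.1)) (by fun_prop) (C.comp_cont _ _ _))
    (ScottContinuous.fun_comp
      (f := fun p : (_ × _) × (_ × _) => (p.1.2, p.2.2)) (by fun_prop) (D.comp_cont _ _ _))

end OCat

/-- Locally continuous functors. -/
structure LCF (C D : OCat) where
  obj : C.Obj → D.Obj
  map : ∀ {X Y}, C.Hom X Y → D.Hom (obj X) (obj Y)
  map_id : ∀ X, map (C.id X) = D.id (obj X)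
  map_comp : ∀ {X Y Z} (f : C.Hom X Y) (g : C.Hom Y Z), map (C.comp f g) = D.comp (map f) (map g)
  map_cont : ∀ X Y, ScottContinuous (map : C.Hom X Y → D.Hom (obj X) (obj Y))

namespace LCF
open OCat
variable {C D E : OCat}

theorem ext_of_heq {F G : LCF C D} (h : ∀ X, F.obj X = G.obj X)
    (h' : ∀ X Y (f : C.Hom X Y), HEq (F.map f) (G.map f)) : F = G := by
  obtain ⟨o, m, _, _, _⟩ := F
  obtain ⟨o', m', _, _, _⟩ := G
  obtain rfl : o = o' := funext h
  obtain rfl : @m = @m' := by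
    funext X Y f
    exact eq_of_heq (h' X Y f)
  rfl

/-- The identity functor. -/
def id (C : OCat) : LCF C C where
  obj X := X
  map f := f
  map_id _ := rfl
  map_comp _ _ := rfl
  map_cont _ _ := ScottContinuous.id

/-- The composite `G ∘ F`. -/
def comp (F : LCF C D) (G : LCF D E) : LCF C E where
  obj X := G.obj (F.obj X)
  map f := G.map (F.map f)
  map_id X := by rw [F.map_id, G.map_id]
  map_comp f g := by rw [F.map_comp, G.map_comp]
  map_cont _ _ := ScottContinuous.fun_comp (F.map_cont _ _) (G.map_cont _ _)

/-- The unique functor to the terminal category. -/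
def terminal (C : OCat) : LCF C OCat.unit where
  obj _ := ⟨⟩
  map _ := ⟨⟩
  map_id _ := rfl
  map_comp _ _ := rfl
  map_cont _ _ := ScottContinuous.const _

def fst (C D : OCat) : LCF (C.prod D) C where
  obj X := X.1
  map f := f.1
  map_id _ := rfl
  map_comp _ _ := rfl
  map_cont _ _ := ScottContinuous.fst

def snd (C D : OCat) : LCF (C.prod D) D where
  obj X := X.2
  map f := f.2
  map_id _ := rfl
  map_comp _ _ := rfl
  map_cont _ _ := ScottContinuous.snd

/-- The pairing `⟨F, G⟩`. -/
def tuple (F : LCF C D) (G : LCF C E) : LCF C (D.prod E) where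
  obj X := (F.obj X, G.obj X)
  map f := (F.map f, G.map f)
  map_id X := by rw [F.map_id, G.map_id]
  map_comp f g := by rw [F.map_comp, G.map_comp]
  map_cont _ _ := (F.map_cont _ _).prodMk (G.map_cont _ _)

/-- The component of a functor to `M × M` at an aspect. -/
def asp (F : LCF C M2) (q : Pol) : LCF C M where
  obj X := F.obj X q
  map f := F.map f q
  map_id X := by rw [F.map_id]
  map_comp f g := by rw [F.map_comp]
  map_cont _ _ := ScottContinuous.fun_comp (F.map_cont _ _) (cont_eval q)

/-- The functor to `M × M` with given negative and positive aspects. -/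
def aspects (F G : LCF C M) : LCF C M2 where
  obj X := Pol.pair (F.obj X) (G.obj X)
  map f := Pol.pair (α := fun q => SMap _ _) (F.map f) (G.map f)
  map_id X := by
    funext q
    cases q
    · exact F.map_id X
    · exact G.map_id X
  map_comp f g := by
    funext q
    cases q
    · exact F.map_comp f g
    · exact G.map_comp f g
  map_cont _ _ := cont_pi fun q => by
    cases q
    · exact F.map_cont _ _
    · exact G.map_cont _ _

/-- The constant functor. -/
noncomputable def const (C : OCat) (D : Dom) : LCF C M where
  obj _ := D
  map _ := SMap.id D
  map_id _ := rfl
  map_comp _ _ := rfl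
  map_cont _ _ := ScottContinuous.const (SMap.id D)

/-- `X ↦ (F X)_⊥`; on morphisms, `f_⊥ ⊥ = ⊥` and `f_⊥ (up d) = up (f d)`. -/
noncomputable def lift (F : LCF C M) : LCF C M where
  obj X := Dom.lift (F.obj X)
  map f := (F.map f).lift
  map_id X := SMap.ext fun x => by
    induction x using WithBot.recBotCoe with
    | bot => rfl
    | coe x => exact congrArg (WithBot.some) (DFunLike.congr_fun (F.map_id X) x)
  map_comp f g := SMap.ext fun x => by
    induction x using WithBot.recBotCoe with
    | bot => rfl
    | coe x => exact congrArg (WithBot.some) (DFunLike.congr_fun (F.map_comp f g) x)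
  map_cont _ _ := SMap.cont_of_apply fun x => by
    induction x using WithBot.recBotCoe with
    | bot => exact ScottContinuous.const ⊥
    | coe x =>
      exact ScottContinuous.fun_comp (SMap.cont_apply (F.map_cont _ _) (ScottContinuous.const x))
        cont_up

/-- `X ↦ F X × G X`. -/
noncomputable def prod (F G : LCF C M) : LCF C M where
  obj X := Dom.prod (F.obj X) (G.obj X)
  map f := ⟨⟨fun x => (F.map f x.1, G.map f x.2), by fun_prop⟩,
    Prod.ext (SMap.map_bot (F.map f)) (SMap.map_bot (G.map f))⟩
  map_id X := SMap.ext fun x =>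
    Prod.ext (DFunLike.congr_fun (F.map_id X) x.1) (DFunLike.congr_fun (G.map_id X) x.2)
  map_comp f g := SMap.ext fun x =>
    Prod.ext (DFunLike.congr_fun (F.map_comp f g) x.1) (DFunLike.congr_fun (G.map_comp f g) x.2)
  map_cont _ _ := SMap.cont_of_apply fun x => ScottContinuous.prodMk
    (SMap.cont_apply (F.map_cont _ _) (ScottContinuous.const x.1))
    (SMap.cont_apply (G.map_cont _ _) (ScottContinuous.const x.2))

/-- `X ↦ ∏ i, F i X`. -/
noncomputable def pi {ι : Type} (F : ι → LCF C M) : LCF C M where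
  obj X := Dom.pi fun i => (F i).obj X
  map f := ⟨⟨fun x i => (F i).map f (x i), by fun_prop⟩,
    funext fun i => SMap.map_bot ((F i).map f)⟩
  map_id X := SMap.ext fun x => funext fun i => DFunLike.congr_fun ((F i).map_id X) (x i)
  map_comp f g := SMap.ext fun x => funext fun i =>
    DFunLike.congr_fun ((F i).map_comp f g) (x i)
  map_cont _ _ := SMap.cont_of_apply fun x => cont_pi fun i =>
    SMap.cont_apply ((F i).map_cont _ _) (ScottContinuous.const (x i))

/-- `X ↦ ⨁ i, (F i X)_⊥`. -/
noncomputable def liftSum {ι : Type} (F : ι → LCF C M) : LCF C M where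
  obj X := Dom.liftSum fun i => (F i).obj X
  map f := SMap.liftSum fun i => (F i).map f
  map_id X := SMap.ext fun x => by
    induction x using WithBot.recBotCoe with
    | bot => rfl
    | coe x =>
      exact congrArg (fun y => WithBot.some (Sigma.mk x.1 y))
        (DFunLike.congr_fun ((F x.1).map_id X) x.2)
  map_comp f g := SMap.ext fun x => by
    induction x using WithBot.recBotCoe with
    | bot => rfl
    | coe x =>
      exact congrArg (fun y => WithBot.some (Sigma.mk x.1 y))
        (DFunLike.congr_fun ((F x.1).map_comp f g) x.2)
  map_cont _ _ := SMap.cont_of_apply fun x => by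
    induction x using WithBot.recBotCoe with
    | bot => exact ScottContinuous.const ⊥
    | coe x =>
      exact ScottContinuous.fun_comp
        (ScottContinuous.fun_comp
          (SMap.cont_apply ((F x.1).map_cont _ _) (ScottContinuous.const x.2)) (cont_sigma_mk x.1))
        cont_up

end LCF

/-! ### Canonical fixed points of locally continuous functors

For a locally continuous functor `G : C × (M × M) → M × M`, the canonical fixed point of `G (X, -)`
is the bilimit of the chain `1, G (X, 1), G (X, G (X, 1)), …`. -/

theorem lim_closed {D : ℕ → Pol → Dom} {p : ∀ n, OCat.M2.Hom (D (n + 1)) (D n)} {q : Pol}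
    (d : Set (∀ n, D n q)) (a : ∀ n, D n q) (hne : d.Nonempty) (hd : DirectedOn (· ≤ ·) d)
    (ha : IsLUB d a) (h : ∀ x ∈ d, ∀ n, p n q (x (n + 1)) = x n) (n : ℕ) :
    p n q (a (n + 1)) = a n := by
  have h1 : IsLUB ((fun y => p n q y) '' (Function.eval (n + 1) '' d)) (p n q (a (n + 1))) :=
    (SMap.cont_coe (p n q)) (hne.image _) (directedOn_image (Function.monotone_eval (n + 1)) hd)
      (isLUB_pi.1 ha (n + 1))
  have h2 := isLUB_pi.1 ha n
  rw [Set.image_image] at h1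
  rw [← Set.image_congr (f := fun x => p n q (Function.eval (n + 1) x)) (fun x hx => h x hx n)] at h2
  exact h1.unique h2

/-- The limit of a sequence of projections `D 0 ← D 1 ← D 2 ← ⋯`. -/
noncomputable def limDom (D : ℕ → Pol → Dom) (p : ∀ n, OCat.M2.Hom (D (n + 1)) (D n)) :
    OCat.M2.Obj := fun q =>
  letI := cpoSubtype (fun x : ∀ n, D n q => ∀ n, p n q (x (n + 1)) = x n)
    (fun n => SMap.map_bot (p n q)) lim_closed
  ⟨{x : ∀ n, D n q // ∀ n, p n q (x (n + 1)) = x n}⟩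

section
variable (D : ℕ → Pol → Dom) (p : ∀ n, OCat.M2.Hom (D (n + 1)) (D n))

theorem limDom_cont_val (q : Pol) : ScottContinuous (fun x : limDom D p q => x.1) :=
  cont_subtype_val _ lim_closed

/-- The projections from the limit. -/
noncomputable def limProj (n : ℕ) : OCat.M2.Hom (limDom D p) (D n) := fun q =>
  ⟨⟨fun x => x.1 n, ScottContinuous.fun_comp (limDom_cont_val D p q) (cont_eval n)⟩, rfl⟩

variable {D p}

theorem limDom_ext {q : Pol} {x y : limDom D p q}
    (h : ∀ n, limProj D p n q x = limProj D p n q y) : x = y := Subtype.ext (funext h)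

theorem limDom_le {q : Pol} {x y : limDom D p q}
    (h : ∀ n, limProj D p n q x ≤ limProj D p n q y) : x ≤ y := h

theorem limProj_comp (n : ℕ) :
    OCat.M2.comp (limProj D p (n + 1)) (p n) = limProj D p n :=
  funext fun _ => SMap.ext fun x => x.2 n

/-- The universal property of the limit. -/
noncomputable def limLift {E : OCat.M2.Obj} (h : ∀ n, OCat.M2.Hom E (D n))
    (hc : ∀ n, OCat.M2.comp (h (n + 1)) (p n) = h n) : OCat.M2.Hom E (limDom D p) := fun q =>
  ⟨⟨fun x => ⟨fun n => h n q x, fun n => DFunLike.congr_fun (congrFun (hc n) q) x⟩,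
    cont_subtype_mk (f := fun x n => h n q x) (cont_pi fun n => (h n q).1.cont) _⟩,
    limDom_ext fun n => SMap.map_bot (h n q)⟩

theorem limLift_proj {E : OCat.M2.Obj} (h : ∀ n, OCat.M2.Hom E (D n))
    (hc : ∀ n, OCat.M2.comp (h (n + 1)) (p n) = h n) (n : ℕ) :
    OCat.M2.comp (limLift h hc) (limProj D p n) = h n := rfl

theorem lim_hom_ext {E : OCat.M2.Obj} {f g : OCat.M2.Hom E (limDom D p)}
    (h : ∀ n, OCat.M2.comp f (limProj D p n) = OCat.M2.comp g (limProj D p n)) : f = g :=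
  funext fun q => SMap.ext fun x => limDom_ext fun n =>
    DFunLike.congr_fun (congrFun (h n) q) x

end

namespace LCF
open OCat
variable {C : OCat} (G : LCF (C.prod M2) M2)

/-- The action of `G` on a pair of morphisms. -/
def map₂ {X Y : C.Obj} {D E : M2.Obj} (f : C.Hom X Y) (h : M2.Hom D E) :
    M2.Hom (G.obj (X, D)) (G.obj (Y, E)) := G.map (X := (X, D)) (Y := (Y, E)) (f, h)

theorem map₂_id (X : C.Obj) (D : M2.Obj) : G.map₂ (C.id X) (M2.id D) = M2.id (G.obj (X, D)) :=
  G.map_id (X, D)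

theorem map₂_comp {X Y Z : C.Obj} {D E F : M2.Obj} (f : C.Hom X Y) (g : C.Hom Y Z)
    (h : M2.Hom D E) (k : M2.Hom E F) :
    M2.comp (G.map₂ f h) (G.map₂ g k) = G.map₂ (C.comp f g) (M2.comp h k) :=
  (G.map_comp (X := (X, D)) (Y := (Y, E)) (Z := (Z, F)) (f, h) (g, k)).symm

theorem map₂_id_comp (X : C.Obj) {D E F : M2.Obj} (h : M2.Hom D E) (k : M2.Hom E F) :
    M2.comp (G.map₂ (C.id X) h) (G.map₂ (C.id X) k) = G.map₂ (C.id X) (M2.comp h k) := by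
  rw [map₂_comp, C.comp_id]

theorem map₂_cont (X Y : C.Obj) (D E : M2.Obj) :
    ScottContinuous (fun p : C.Hom X Y × M2.Hom D E => G.map₂ p.1 p.2) :=
  G.map_cont (X, D) (Y, E)

theorem map₂_cont_right {X Y : C.Obj} (f : C.Hom X Y) (D E : M2.Obj) :
    ScottContinuous (fun h : M2.Hom D E => G.map₂ f h) :=
  ScottContinuous.fun_comp (f := fun h => (f, h)) (by fun_prop) (G.map₂_cont X Y D E)

/-- The iterates `G (X, -)^n 1`. -/
noncomputable def approx (X : C.Obj) (n : ℕ) : M2.Obj :=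
  Nat.rec (fun _ => Dom.unit) (fun _ D => G.obj (X, D)) n

/-- The projections between the iterates. -/
noncomputable def approxProj (X : C.Obj) (n : ℕ) :
    M2.Hom (G.approx X (n + 1)) (G.approx X n) :=
  Nat.rec (motive := fun n => M2.Hom (G.approx X (n + 1)) (G.approx X n)) ⊥
    (fun _ p => G.map₂ (C.id X) p) n

/-- The action of the iterates on morphisms. -/
noncomputable def approxMap {X Y : C.Obj} (f : C.Hom X Y) (n : ℕ) :
    M2.Hom (G.approx X n) (G.approx Y n) :=
  Nat.rec (motive := fun n => M2.Hom (G.approx X n) (G.approx Y n)) ⊥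
    (fun _ h => G.map₂ f h) n

theorem approxProj_succ (X : C.Obj) (n : ℕ) :
    G.approxProj X (n + 1) = G.map₂ (C.id X) (G.approxProj X n) := rfl

theorem approxMap_succ {X Y : C.Obj} (f : C.Hom X Y) (n : ℕ) :
    G.approxMap f (n + 1) = G.map₂ f (G.approxMap f n) := rfl

theorem hom_unit_ext {E : M2.Obj} {X : C.Obj} (f g : M2.Hom E (G.approx X 0)) : f = g :=
  funext fun _ => SMap.ext fun _ => rfl

theorem approxMap_comm {X Y : C.Obj} (f : C.Hom X Y) (n : ℕ) :
    M2.comp (G.approxMap f (n + 1)) (G.approxProj Y n) =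
      M2.comp (G.approxProj X n) (G.approxMap f n) := by
  induction n with
  | zero => exact G.hom_unit_ext _ _
  | succ n ih =>
    refine (G.map₂_comp f (C.id Y) (G.approxMap f (n + 1)) (G.approxProj Y n)).trans ?_
    refine Eq.trans ?_ (G.map₂_comp (C.id X) f (G.approxProj X n) (G.approxMap f n)).symm
    rw [C.comp_id, C.id_comp, ih]

theorem approxMap_id (X : C.Obj) (n : ℕ) :
    G.approxMap (C.id X) n = M2.id (G.approx X n) := by
  induction n with
  | zero => exact G.hom_unit_ext _ _
  | succ n ih =>
    rw [approxMap_succ, ih]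
    exact G.map₂_id X _

theorem approxMap_comp {X Y Z : C.Obj} (f : C.Hom X Y) (g : C.Hom Y Z) (n : ℕ) :
    G.approxMap (C.comp f g) n = M2.comp (G.approxMap f n) (G.approxMap g n) := by
  induction n with
  | zero => exact G.hom_unit_ext _ _
  | succ n ih =>
    rw [approxMap_succ, ih]
    exact (G.map₂_comp f g (G.approxMap f n) (G.approxMap g n)).symm

theorem approxMap_cont (X Y : C.Obj) (n : ℕ) :
    ScottContinuous (fun f : C.Hom X Y => G.approxMap f n) := by
  induction n with
  | zero => exact ScottContinuous.const _
  | succ n ih =>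
    exact ScottContinuous.fun_comp (f := fun f : C.Hom X Y => (f, G.approxMap f n))
      (ScottContinuous.id.prodMk ih) (G.map₂_cont X Y (G.approx X n) (G.approx Y n))

theorem approxMap_lim {X Y : C.Obj} (f : C.Hom X Y) (n : ℕ) :
    M2.comp (M2.comp (limProj _ (G.approxProj X) (n + 1)) (G.approxMap f (n + 1)))
      (G.approxProj Y n) = M2.comp (limProj _ (G.approxProj X) n) (G.approxMap f n) := by
  rw [M2.assoc, approxMap_comm, ← M2.assoc, limProj_comp]

/-- The parametrized canonical fixed point `X ↦ FIX (G (X, -))`. -/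
noncomputable def sfix : LCF C M2 where
  obj X := limDom (G.approx X) (G.approxProj X)
  map {X Y} f := limLift (fun n => M2.comp (limProj _ _ n) (G.approxMap f n)) (G.approxMap_lim f)
  map_id X := lim_hom_ext fun n => by
    rw [limLift_proj, approxMap_id, M2.comp_id, M2.id_comp]
  map_comp {X Y Z} f g := lim_hom_ext fun n => by
    rw [limLift_proj, approxMap_comp]
    rfl
  map_cont X Y := cont_pi fun q => SMap.cont_of_apply fun x =>
    cont_subtype_mk (f := fun (f : C.Hom X Y) n => G.approxMap f n q (x.1 n))
      (cont_pi fun n => SMap.cont_apply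
        (ScottContinuous.fun_comp (G.approxMap_cont X Y n) (cont_eval q))
        (ScottContinuous.const _)) _

/-- The projections of the fixed point onto the iterates. -/
noncomputable def fixProj (X : C.Obj) (n : ℕ) : M2.Hom (G.sfix.obj X) (G.approx X n) :=
  limProj _ _ n

theorem fixProj_comp (X : C.Obj) (n : ℕ) :
    M2.comp (G.fixProj X (n + 1)) (G.approxProj X n) = G.fixProj X n := limProj_comp n

/-- `Fold : G (X, FIX (G (X, -))) → FIX (G (X, -))`. -/
noncomputable def fold (X : C.Obj) : M2.Hom (G.obj (X, G.sfix.obj X)) (G.sfix.obj X) :=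
  limLift (fun n => Nat.rec (motive := fun n => M2.Hom _ (G.approx X n)) ⊥
      (fun n _ => G.map₂ (C.id X) (G.fixProj X n)) n) fun n => by
    cases n with
    | zero => exact G.hom_unit_ext _ _
    | succ n =>
      exact (G.map₂_id_comp X (G.fixProj X (n + 1)) (G.approxProj X n)).trans
        (congrArg (G.map₂ (C.id X)) (G.fixProj_comp X n))

theorem fold_proj (X : C.Obj) (n : ℕ) :
    M2.comp (G.fold X) (G.fixProj X (n + 1)) = G.map₂ (C.id X) (G.fixProj X n) := rfl

/-- The embeddings of the iterates into the fixed point. -/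
noncomputable def emb (X : C.Obj) (n : ℕ) : M2.Hom (G.approx X n) (G.sfix.obj X) :=
  Nat.rec (motive := fun n => M2.Hom (G.approx X n) (G.sfix.obj X)) ⊥
    (fun _ e => M2.comp (G.map₂ (C.id X) e) (G.fold X)) n

theorem emb_succ (X : C.Obj) (n : ℕ) :
    G.emb X (n + 1) = M2.comp (G.map₂ (C.id X) (G.emb X n)) (G.fold X) := rfl

/-- The step `G (X, ι_n) ∘ π_{n+1}` of the inverse of `Fold`. -/
noncomputable def unfoldStep (X : C.Obj) (n : ℕ) :
    M2.Hom (G.sfix.obj X) (G.obj (X, G.sfix.obj X)) :=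
  M2.comp (G.fixProj X (n + 1)) (G.map₂ (C.id X) (G.emb X n))

/-- `Unfold = ⨆ n, G (X, ι_n) ∘ π_{n+1}`. -/
noncomputable def unfold (X : C.Obj) : M2.Hom (G.sfix.obj X) (G.obj (X, G.sfix.obj X)) :=
  fun q => sSup (Set.range fun n => G.unfoldStep X n q)

theorem comp_mono {D E F : M2.Obj} {f f' : M2.Hom D E} {g g' : M2.Hom E F} (hf : f ≤ f')
    (hg : g ≤ g') : M2.comp f g ≤ M2.comp f' g' :=
  (M2.comp_cont D E F).monotone (a := (f, g)) (b := (f', g')) ⟨hf, hg⟩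

theorem approxProj_emb_le (X : C.Obj) (n : ℕ) :
    M2.comp (G.approxProj X n) (G.emb X n) ≤ G.emb X (n + 1) := by
  induction n with
  | zero => exact (bot_le : (⊥ : M2.Hom _ _) ≤ _)
  | succ n ih =>
    have h := G.map₂_id_comp X (G.approxProj X n) (G.emb X n)
    have h' := comp_mono (h.le.trans ((G.map₂_cont_right (C.id X) _ _).monotone ih))
      (le_refl (G.fold X))
    exact h'

theorem emb_proj (X : C.Obj) (n : ℕ) :
    M2.comp (G.emb X n) (G.fixProj X n) = M2.id (G.approx X n) := by
  induction n with
  | zero => exact G.hom_unit_ext _ _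
  | succ n ih =>
    refine (G.map₂_id_comp X (G.emb X n) (G.fixProj X n)).trans ?_
    rw [ih]
    exact G.map₂_id X _

theorem unfoldStep_mono (X : C.Obj) : Monotone (G.unfoldStep X) := by
  refine monotone_nat_of_le_succ fun n => ?_
  unfold unfoldStep
  rw [← G.fixProj_comp X (n + 1)]
  have h := G.map₂_id_comp X (G.approxProj X n) (G.emb X n)
  exact comp_mono (le_refl (G.fixProj X (n + 1 + 1)))
    (h.le.trans ((G.map₂_cont_right (C.id X) _ _).monotone (G.approxProj_emb_le X n)))

theorem isLUB_unfold (X : C.Obj) : IsLUB (Set.range (G.unfoldStep X)) (G.unfold X) := by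
  refine isLUB_pi.2 fun q => ?_
  rw [← Set.range_comp]
  have h : Monotone fun n => G.unfoldStep X n q := fun _ _ hmn => G.unfoldStep_mono X hmn q
  exact h.directed_le.directedOn_range.isLUB_sSup

theorem retr_mono (X : C.Obj) : Monotone fun n => M2.comp (G.fixProj X n) (G.emb X n) := by
  refine monotone_nat_of_le_succ fun n => ?_
  rw [← G.fixProj_comp X n, M2.assoc]
  exact comp_mono le_rfl (G.approxProj_emb_le X n)

theorem retr_proj (X : C.Obj) {m n : ℕ} (h : m ≤ n) :
    M2.comp (M2.comp (G.fixProj X n) (G.emb X n)) (G.fixProj X m) = G.fixProj X m := by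
  obtain ⟨g, hg⟩ : ∃ g, G.fixProj X m = M2.comp (G.fixProj X n) g := by
    induction n, h using Nat.le_induction with
    | base => exact ⟨M2.id _, rfl⟩
    | succ n _ ih =>
      obtain ⟨g, hg⟩ := ih
      exact ⟨M2.comp (G.approxProj X n) g, by rw [hg, ← G.fixProj_comp X n]; rfl⟩
  rw [hg, ← M2.assoc, M2.assoc _ (G.emb X n), emb_proj, M2.comp_id]

theorem isLUB_retr (X : C.Obj) :
    IsLUB (Set.range fun n => M2.comp (G.fixProj X n) (G.emb X n)) (M2.id (G.sfix.obj X)) := by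
  refine ⟨?_, ?_⟩
  · rintro _ ⟨n, rfl⟩ q x
    refine limDom_le fun m => ?_
    have h1 := G.retr_mono X (le_max_left n m) q x
    have h2 := DFunLike.congr_fun (congrFun (G.retr_proj X (le_max_right n m)) q) x
    refine ((SMap.cont_coe (limProj _ _ m q)).monotone h1).trans ?_
    exact h2.le
  · intro b hb q x
    refine limDom_le fun m => ?_
    have h1 := hb ⟨m, rfl⟩ q x
    have h2 := DFunLike.congr_fun (congrFun (G.retr_proj X (le_refl m)) q) x
    refine (h2.symm.le : _).trans ?_
    exact (SMap.cont_coe (limProj _ _ m q)).monotone h1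

theorem fold_unfold (X : C.Obj) :
    M2.comp (G.fold X) (G.unfold X) = M2.id (G.obj (X, G.sfix.obj X)) := by
  have h1 : ScottContinuous fun g : M2.Hom _ (G.obj (X, G.sfix.obj X)) => M2.comp (G.fold X) g :=
    ScottContinuous.fun_comp (f := fun g => (G.fold X, g)) (by fun_prop) (M2.comp_cont _ _ _)
  have h2 := h1 (Set.range_nonempty _) (G.unfoldStep_mono X).directed_le.directedOn_range
    (G.isLUB_unfold X)
  have h3 := G.map₂_cont_right (C.id X) _ _ (Set.range_nonempty _)
    (G.retr_mono X).directed_le.directedOn_range (G.isLUB_retr X)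
  rw [← Set.range_comp] at h2 h3
  refine h2.unique ?_
  rw [← map₂_id]
  convert h3 using 2
  funext n
  exact G.map₂_id_comp X (G.fixProj X n) (G.emb X n)

theorem unfold_fold (X : C.Obj) :
    M2.comp (G.unfold X) (G.fold X) = M2.id (G.sfix.obj X) := by
  have h1 : ScottContinuous fun g : M2.Hom (G.sfix.obj X) _ => M2.comp g (G.fold X) :=
    ScottContinuous.fun_comp (f := fun g => (g, G.fold X)) (by fun_prop) (M2.comp_cont _ _ _)
  have h2 := h1 (Set.range_nonempty _) (G.unfoldStep_mono X).directed_le.directedOn_range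
    (G.isLUB_unfold X)
  rw [← Set.range_comp] at h2
  refine h2.unique ⟨?_, ?_⟩
  · rintro _ ⟨n, rfl⟩
    exact (G.isLUB_retr X).1 ⟨n + 1, rfl⟩
  · intro b hb
    refine (G.isLUB_retr X).2 ?_
    rintro _ ⟨n, rfl⟩
    exact (G.retr_mono X n.le_succ).trans (hb ⟨n, rfl⟩)

end LCF

/-! ### Types -/

/-- Labels of choice types. -/
abbrev Label := ℕ

/-- The type variables of polarity `p` in a context `Ξ` of polarized type variables. -/
inductive TVar : List Pol → Pol → Type
  | here {Ξ : List Pol} {p : Pol} : TVar (p :: Ξ) p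
  | there {Ξ : List Pol} {p q : Pol} (α : TVar Ξ p) : TVar (q :: Ξ) p

mutual

/-- Functional types: quoted processes `{a : A ← a₁ : A₁, …, aₙ : Aₙ}` and functions. -/
inductive FTy : Type
  | proc {p : Pol} (A : STy [] p) (Δ : LCtx) : FTy
  | arrow (τ σ : FTy) : FTy

/-- Lists `a₁ : A₁, …, aₙ : Aₙ` of channels with closed session types. A channel name is a position
in the list. -/
inductive LCtx : Type
  | nil : LCtx
  | cons {p : Pol} (A : STy [] p) (Δ : LCtx) : LCtx

/-- `STy Ξ p` is the type of session types `A` with `Ξ ⊢ A` of polarity `p`. -/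
inductive STy : List Pol → Pol → Type
  | one {Ξ : List Pol} : STy Ξ .pos
  | var {Ξ : List Pol} {p : Pol} (α : TVar Ξ p) : STy Ξ p
  | mu {Ξ : List Pol} {p : Pol} (A : STy (p :: Ξ) p) : STy Ξ p
  | dshift {Ξ : List Pol} (A : STy Ξ .neg) : STy Ξ .pos
  | ushift {Ξ : List Pol} (A : STy Ξ .pos) : STy Ξ .neg
  | plus {Ξ : List Pol} (L : Finset Label) (A : L → STy Ξ .pos) : STy Ξ .pos
  | amp {Ξ : List Pol} (L : Finset Label) (A : L → STy Ξ .neg) : STy Ξ .neg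
  | tensor {Ξ : List Pol} (A B : STy Ξ .pos) : STy Ξ .pos
  | lolly {Ξ : List Pol} (A : STy Ξ .pos) (B : STy Ξ .neg) : STy Ξ .neg
  | and {Ξ : List Pol} (τ : FTy) (A : STy Ξ .pos) : STy Ξ .pos
  | imp {Ξ : List Pol} (τ : FTy) (A : STy Ξ .neg) : STy Ξ .neg

end

/-- The category `⟦Ξ⟧`: an object assigns to each type variable a pair of domains, its negative and
its positive aspect. -/
noncomputable def TEnv : List Pol → OCat
  | [] => OCat.unit
  | _ :: Ξ => (TEnv Ξ).prod OCat.M2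

/-- The projection functor `π_α`. -/
noncomputable def TVar.den : ∀ {Ξ : List Pol} {p : Pol}, TVar Ξ p → LCF (TEnv Ξ) OCat.M2
  | _ :: Ξ, _, .here => LCF.snd (TEnv Ξ) OCat.M2
  | _ :: Ξ, _, .there α => (LCF.fst (TEnv Ξ) OCat.M2).comp α.den

mutual

/-- The domain denoted by a functional type. -/
noncomputable def FTy.den : FTy → Dom
  | .proc A Δ => Dom.lift (Dom.fn (Dom.prod (Δ.den .pos) (A.den.obj ⟨⟩ .neg))
      (Dom.prod (Δ.den .neg) (A.den.obj ⟨⟩ .pos)))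
  | .arrow τ σ => Dom.sfn τ.den σ.den

/-- The product `⟦Δ⟧^q` of the aspects `⟦Aᵢ⟧^q` of the types in `Δ`. -/
noncomputable def LCtx.den : LCtx → Pol → Dom
  | .nil, _ => Dom.unit
  | .cons A Δ, q => Dom.prod (A.den.obj ⟨⟩ q) (Δ.den q)

/-- The negative and positive aspects of a session type, as a locally continuous functor. -/
noncomputable def STy.den : {Ξ : List Pol} → {p : Pol} → STy Ξ p → LCF (TEnv Ξ) OCat.M2
  | Ξ, _, .one => LCF.aspects (LCF.const (TEnv Ξ) Dom.unit) (LCF.const (TEnv Ξ) (Dom.lift Dom.unit))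
  | _, _, .var α => α.den
  | _, _, .mu A => A.den.sfix
  | _, _, .dshift A => LCF.aspects (A.den.asp .neg) (A.den.asp .pos).lift
  | _, _, .ushift A => LCF.aspects (A.den.asp .neg).lift (A.den.asp .pos)
  | _, _, .plus _ A =>
    LCF.aspects (LCF.pi fun l => (A l).den.asp .neg) (LCF.liftSum fun l => (A l).den.asp .pos)
  | _, _, .amp _ A =>
    LCF.aspects (LCF.liftSum fun l => (A l).den.asp .neg) (LCF.pi fun l => (A l).den.asp .pos)
  | _, _, .tensor A B =>
    LCF.aspects ((A.den.asp .neg).prod (B.den.asp .neg)) ((A.den.asp .pos).prod (B.den.asp .pos)).lift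
  | _, _, .lolly A B =>
    LCF.aspects ((A.den.asp .pos).prod (B.den.asp .neg)).lift ((A.den.asp .neg).prod (B.den.asp .pos))
  | Ξ, _, .and τ A =>
    LCF.aspects (A.den.asp .neg) ((LCF.const (TEnv Ξ) τ.den).prod (A.den.asp .pos)).lift
  | Ξ, _, .imp τ A =>
    LCF.aspects ((LCF.const (TEnv Ξ) τ.den).prod (A.den.asp .neg)).lift (A.den.asp .pos)

end

/-- The aspect `⟦A⟧^q` of a closed session type. -/
noncomputable abbrev STy.aspect {p : Pol} (A : STy [] p) (q : Pol) : Dom := A.den.obj ⟨⟩ q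

/-! ### Substitution of session types -/

/-- Extension of a renaming under a binder. -/
def TVar.extend {Ξ Θ : List Pol} {q : Pol} (ρ : ∀ p, TVar Ξ p → TVar Θ p) :
    ∀ p, TVar (q :: Ξ) p → TVar (q :: Θ) p
  | _, .here => .here
  | p, .there α => .there (ρ p α)

/-- Renaming of type variables. -/
def STy.rename : {Ξ Θ : List Pol} → {p : Pol} → (∀ p, TVar Ξ p → TVar Θ p) → STy Ξ p → STy Θ p
  | _, _, _, _, .one => .one
  | _, _, p, ρ, .var α => .var (ρ p α)
  | _, _, _, ρ, .mu A => .mu (A.rename (TVar.extend ρ))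
  | _, _, _, ρ, .dshift A => .dshift (A.rename ρ)
  | _, _, _, ρ, .ushift A => .ushift (A.rename ρ)
  | _, _, _, ρ, .plus L A => .plus L fun l => (A l).rename ρ
  | _, _, _, ρ, .amp L A => .amp L fun l => (A l).rename ρ
  | _, _, _, ρ, .tensor A B => .tensor (A.rename ρ) (B.rename ρ)
  | _, _, _, ρ, .lolly A B => .lolly (A.rename ρ) (B.rename ρ)
  | _, _, _, ρ, .and τ A => .and τ (A.rename ρ)
  | _, _, _, ρ, .imp τ A => .imp τ (A.rename ρ)

/-- Extension of a substitution under a binder. -/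
def STy.extend {Ξ Θ : List Pol} {q : Pol} (σ : ∀ p, TVar Ξ p → STy Θ p) :
    ∀ p, TVar (q :: Ξ) p → STy (q :: Θ) p
  | _, .here => .var .here
  | p, .there α => (σ p α).rename fun _ => .there

/-- Simultaneous substitution of session types for type variables. -/
def STy.subst : {Ξ Θ : List Pol} → {p : Pol} → (∀ p, TVar Ξ p → STy Θ p) → STy Ξ p → STy Θ p
  | _, _, _, _, .one => .one
  | _, _, p, σ, .var α => σ p α
  | _, _, _, σ, .mu A => .mu (A.subst (STy.extend σ))
  | _, _, _, σ, .dshift A => .dshift (A.subst σ)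
  | _, _, _, σ, .ushift A => .ushift (A.subst σ)
  | _, _, _, σ, .plus L A => .plus L fun l => (A l).subst σ
  | _, _, _, σ, .amp L A => .amp L fun l => (A l).subst σ
  | _, _, _, σ, .tensor A B => .tensor (A.subst σ) (B.subst σ)
  | _, _, _, σ, .lolly A B => .lolly (A.subst σ) (B.subst σ)
  | _, _, _, σ, .and τ A => .and τ (A.subst σ)
  | _, _, _, σ, .imp τ A => .imp τ (A.subst σ)

/-- The substitution `[A/α]` for the single variable of the context `α`. -/
def STy.inst {p : Pol} (A : STy [] p) : ∀ q, TVar [p] q → STy [] q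
  | _, .here => A

/-- The unfolding `[ρα.A/α]A`. -/
def STy.unfolding {p : Pol} (A : STy [p] p) : STy [] p := A.subst (STy.inst (.mu A))

/-! ### Semantic substitution of session types

`Fold` and `Unfold` at `ρα.A` have to be composed with the denotations of processes at
`[ρα.A/α]A`; this uses that substitution of session types is composition. -/

theorem limDom_congr {D : ℕ → Pol → Dom} {p p' : ∀ n, OCat.M2.Hom (D (n + 1)) (D n)}
    (h : p = p') : limDom D p = limDom D p' := by rw [h]

theorem limMap_heq {D E : ℕ → Pol → Dom} {p p' : ∀ n, OCat.M2.Hom (D (n + 1)) (D n)}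
    {r r' : ∀ n, OCat.M2.Hom (E (n + 1)) (E n)} (hp : p = p') (hr : r = r')
    {f f' : ∀ n, OCat.M2.Hom (D n) (E n)} (hf : f = f')
    {h1 : ∀ n, OCat.M2.comp (OCat.M2.comp (limProj D p (n + 1)) (f (n + 1))) (r n) =
      OCat.M2.comp (limProj D p n) (f n)}
    {h2 : ∀ n, OCat.M2.comp (OCat.M2.comp (limProj D p' (n + 1)) (f' (n + 1))) (r' n) =
      OCat.M2.comp (limProj D p' n) (f' n)} :
    HEq (limLift (D := E) (p := r) (fun n => OCat.M2.comp (limProj D p n) (f n)) h1)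
      (limLift (D := E) (p := r') (fun n => OCat.M2.comp (limProj D p' n) (f' n)) h2) := by
  subst hp hr hf
  rfl

theorem LCF.sfix_comp {C D : OCat} (S : LCF C D) (G : LCF (D.prod OCat.M2) OCat.M2) :
    (((LCF.tuple ((LCF.fst C OCat.M2).comp S) (LCF.snd C OCat.M2)).comp G).sfix : LCF C OCat.M2) =
      S.comp G.sfix := by
  set H := (LCF.tuple ((LCF.fst C OCat.M2).comp S) (LCF.snd C OCat.M2)).comp G with hH
  have hp : ∀ X, (H.approxProj X : ∀ n, OCat.M2.Hom (G.approx (S.obj X) (n + 1)) _) =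
      G.approxProj (S.obj X) := by
    intro X
    funext n
    induction n with
    | zero => rfl
    | succ n ih =>
      have h1 : H.approxProj X (n + 1) = G.map₂ (S.map (C.id X)) (H.approxProj X n) := rfl
      rw [h1, S.map_id, ih]
      rfl
  have hm : ∀ X Y (f : C.Hom X Y) n, H.approxMap f n = G.approxMap (S.map f) n := by
    intro X Y f n
    induction n with
    | zero => rfl
    | succ n ih =>
      have h1 : H.approxMap f (n + 1) = G.map₂ (S.map f) (H.approxMap f n) := rfl
      rw [h1, ih]
      rfl
  refine LCF.ext_of_heq (fun X => limDom_congr (hp X)) fun X Y f => ?_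
  exact limMap_heq (hp X) (hp Y) (funext fun n => hm X Y f n) (h1 := H.approxMap_lim f)
    (h2 := G.approxMap_lim (S.map f))

/-- The functor into `⟦Ξ⟧` with given components. -/
noncomputable def TEnv.tuple {C : OCat} :
    ∀ {Ξ : List Pol}, (∀ p, TVar Ξ p → LCF C OCat.M2) → LCF C (TEnv Ξ)
  | [], _ => LCF.terminal C
  | _ :: _, s => LCF.tuple (TEnv.tuple fun p α => s p (.there α)) (s _ .here)

theorem TEnv.comp_tuple {C D : OCat} (F : LCF C D) {Ξ : List Pol}
    (s : ∀ p, TVar Ξ p → LCF D OCat.M2) :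
    F.comp (TEnv.tuple s) = TEnv.tuple fun p α => F.comp (s p α) := by
  induction Ξ with
  | nil => rfl
  | cons p Ξ ih => exact congrArg (fun T => LCF.tuple T (F.comp (s _ .here))) (ih _)

theorem TEnv.tuple_var {C : OCat} {Ξ : List Pol} (s : ∀ p, TVar Ξ p → LCF C OCat.M2)
    {p : Pol} (α : TVar Ξ p) : (TEnv.tuple s).comp α.den = s p α := by
  induction α with
  | here => rfl
  | there α ih => exact ih fun p α => s p (.there α)

theorem TEnv.tuple_extend {C : OCat} {Ξ : List Pol} {q : Pol}
    (s : ∀ p, TVar Ξ p → LCF C OCat.M2)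
    (t : ∀ p, TVar (q :: Ξ) p → LCF (C.prod OCat.M2) OCat.M2)
    (h : ∀ p α, t p (.there α) = (LCF.fst C OCat.M2).comp (s p α))
    (h' : t q .here = LCF.snd C OCat.M2) :
    TEnv.tuple t =
      LCF.tuple ((LCF.fst C OCat.M2).comp (TEnv.tuple s)) (LCF.snd C OCat.M2) := by
  rw [TEnv.comp_tuple]
  simp only [TEnv.tuple, h, h']
  rfl

theorem STy.den_rename {Ξ Θ : List Pol} {p : Pol} (ρ : ∀ p, TVar Ξ p → TVar Θ p) (A : STy Ξ p) :
    (A.rename ρ).den = (TEnv.tuple fun p α => (ρ p α).den).comp A.den := by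
  match Ξ, p, A with
  | _, _, .one => simp only [STy.rename, STy.den]; rfl
  | _, _, .var α => simp only [STy.rename, STy.den, TEnv.tuple_var]
  | _, p, .mu A =>
    simp only [STy.rename, STy.den]
    have h := TEnv.tuple_extend (fun p α => (ρ p α).den)
      (fun r α => (TVar.extend (q := p) ρ r α).den) (fun _ _ => rfl) rfl
    exact (congrArg LCF.sfix ((STy.den_rename (TVar.extend ρ) A).trans
      (congrArg (fun T => T.comp A.den) h))).trans (LCF.sfix_comp _ _)
  | _, _, .dshift A => simp only [STy.rename, STy.den, STy.den_rename ρ A]; rfl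
  | _, _, .ushift A => simp only [STy.rename, STy.den, STy.den_rename ρ A]; rfl
  | _, _, .plus L A => simp only [STy.rename, STy.den, fun l => STy.den_rename ρ (A l)]; rfl
  | _, _, .amp L A => simp only [STy.rename, STy.den, fun l => STy.den_rename ρ (A l)]; rfl
  | _, _, .tensor A B =>
    simp only [STy.rename, STy.den, STy.den_rename ρ A, STy.den_rename ρ B]; rfl
  | _, _, .lolly A B =>
    simp only [STy.rename, STy.den, STy.den_rename ρ A, STy.den_rename ρ B]; rfl
  | _, _, .and τ A => simp only [STy.rename, STy.den, STy.den_rename ρ A]; rfl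
  | _, _, .imp τ A => simp only [STy.rename, STy.den, STy.den_rename ρ A]; rfl

theorem TEnv.tuple_id (Ξ : List Pol) : (TEnv.tuple fun _ α => α.den) = LCF.id (TEnv Ξ) := by
  induction Ξ with
  | nil => rfl
  | cons q Ξ ih =>
    refine (TEnv.tuple_extend (fun _ α => α.den) _ (fun _ _ => rfl) rfl).trans ?_
    rw [ih]
    rfl

theorem STy.den_subst {Ξ Θ : List Pol} {p : Pol} (σ : ∀ p, TVar Ξ p → STy Θ p) (A : STy Ξ p) :
    (A.subst σ).den = (TEnv.tuple fun p α => (σ p α).den).comp A.den := by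
  match Ξ, p, A with
  | _, _, .one => simp only [STy.subst, STy.den]; rfl
  | _, _, .var α => simp only [STy.subst, STy.den, TEnv.tuple_var]
  | _, p, .mu A =>
    simp only [STy.subst, STy.den]
    have h := TEnv.tuple_extend (fun p α => (σ p α).den)
      (fun r α => (STy.extend (q := p) σ r α).den)
      (fun r α => by
        refine (STy.den_rename _ _).trans (congrArg (fun T => LCF.comp T _) ?_)
        refine (TEnv.comp_tuple (LCF.fst (TEnv Θ) OCat.M2) fun _ α => α.den).symm.trans ?_
        rw [TEnv.tuple_id]
        rfl) rfl
    exact (congrArg LCF.sfix ((STy.den_subst (STy.extend σ) A).trans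
      (congrArg (fun T => T.comp A.den) h))).trans (LCF.sfix_comp _ _)
  | _, _, .dshift A => simp only [STy.subst, STy.den, STy.den_subst σ A]; rfl
  | _, _, .ushift A => simp only [STy.subst, STy.den, STy.den_subst σ A]; rfl
  | _, _, .plus L A => simp only [STy.subst, STy.den, fun l => STy.den_subst σ (A l)]; rfl
  | _, _, .amp L A => simp only [STy.subst, STy.den, fun l => STy.den_subst σ (A l)]; rfl
  | _, _, .tensor A B =>
    simp only [STy.subst, STy.den, STy.den_subst σ A, STy.den_subst σ B]; rfl
  | _, _, .lolly A B =>
    simp only [STy.subst, STy.den, STy.den_subst σ A, STy.den_subst σ B]; rfl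
  | _, _, .and τ A => simp only [STy.subst, STy.den, STy.den_subst σ A]; rfl
  | _, _, .imp τ A => simp only [STy.subst, STy.den, STy.den_subst σ A]; rfl

theorem STy.den_unfolding {p : Pol} (A : STy [p] p) (q : Pol) :
    A.den.obj (⟨⟩, (STy.mu A).den.obj ⟨⟩) q = A.unfolding.aspect q := by
  have h := STy.den_subst (STy.inst (.mu A)) A
  exact (congrArg (fun F : LCF OCat.unit OCat.M2 => F.obj ⟨⟩ q) h).symm

/-- The identity between equal domains. -/
noncomputable def SMap.ofEq {D E : Dom} (h : D = E) : SMap D E := h ▸ SMap.id D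

/-- `Fold : ⟦[ρα.A/α]A⟧^q → ⟦ρα.A⟧^q`. -/
noncomputable def STy.fold {p : Pol} (A : STy [p] p) (q : Pol) :
    SMap (A.unfolding.aspect q) ((STy.mu A).aspect q) :=
  (SMap.ofEq (A.den_unfolding q).symm).comp (A.den.fold ⟨⟩ q)

/-- `Unfold : ⟦ρα.A⟧^q → ⟦[ρα.A/α]A⟧^q`. -/
noncomputable def STy.unfold {p : Pol} (A : STy [p] p) (q : Pol) :
    SMap ((STy.mu A).aspect q) (A.unfolding.aspect q) :=
  (A.den.unfold ⟨⟩ q).comp (SMap.ofEq (A.den_unfolding q))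

/-! ### Typing derivations of functional terms and processes -/

/-- Structural contexts `Ψ = x₁ : τ₁, …, xₙ : τₙ`. -/
abbrev FCtx := List FTy

/-- `Var Ψ τ` is the type of variables of type `τ` in the context `Ψ`. -/
inductive Var : FCtx → FTy → Type
  | here {Ψ : FCtx} {τ : FTy} : Var (τ :: Ψ) τ
  | there {Ψ : FCtx} {τ σ : FTy} (x : Var Ψ τ) : Var (σ :: Ψ) τ

/-- `Pick A Δ Δ'` is the type of channels `a : A` in `Δ` that leave `Δ'`. -/
inductive Pick {p : Pol} (A : STy [] p) : LCtx → LCtx → Type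
  | here {Δ : LCtx} : Pick A (.cons A Δ) Δ
  | there {q : Pol} {B : STy [] q} {Δ Δ' : LCtx} (a : Pick A Δ Δ') :
      Pick A (.cons B Δ) (.cons B Δ')

/-- `Split Δ Δ₁ Δ₂` is the type of partitions of the channels in `Δ` into `Δ₁` and `Δ₂`. -/
inductive Split : LCtx → LCtx → LCtx → Type
  | nil : Split .nil .nil .nil
  | left {p : Pol} {A : STy [] p} {Δ Δ₁ Δ₂ : LCtx} (s : Split Δ Δ₁ Δ₂) :
      Split (.cons A Δ) (.cons A Δ₁) Δ₂
  | right {p : Pol} {A : STy [] p} {Δ Δ₁ Δ₂ : LCtx} (s : Split Δ Δ₁ Δ₂) :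
      Split (.cons A Δ) Δ₁ (.cons A Δ₂)

/-- `Args Δ Γ` is the type of enumerations `a₁, …, aₙ` of all the channels in `Δ` such that
`a₁ : A₁, …, aₙ : Aₙ` is the list `Γ`. -/
inductive Args : LCtx → LCtx → Type
  | nil : Args .nil .nil
  | cons {p : Pol} {A : STy [] p} {Δ Δ' Γ : LCtx} (a : Pick A Δ Δ') (as : Args Δ' Γ) :
      Args Δ (.cons A Γ)

mutual

/-- `Tm Ψ τ` is the type of functional terms `M` with `Ψ ⊢ M : τ`. -/
inductive Tm : FCtx → FTy → Type
  /-- `x` -/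
  | var {Ψ : FCtx} {τ : FTy} (x : Var Ψ τ) : Tm Ψ τ
  /-- `fix x.M` -/
  | fix {Ψ : FCtx} {τ : FTy} (M : Tm (τ :: Ψ) τ) : Tm Ψ τ
  /-- `λ x : τ.M` -/
  | lam {Ψ : FCtx} {τ σ : FTy} (M : Tm (τ :: Ψ) σ) : Tm Ψ (.arrow τ σ)
  /-- `M N` -/
  | app {Ψ : FCtx} {τ σ : FTy} (M : Tm Ψ (.arrow τ σ)) (N : Tm Ψ τ) : Tm Ψ σ
  /-- `a ← {P} ← a₁, …, aₙ` -/
  | quote {Ψ : FCtx} {Δ : LCtx} {p : Pol} {A : STy [] p} (P : Proc Ψ Δ A) : Tm Ψ (.proc A Δ)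

/-- `Proc Ψ Δ C` is the type of processes `P` with `Ψ ; Δ ⊢ P :: c : C`. Channels introduced in a
premise are at the front of its list of channels. -/
inductive Proc : FCtx → LCtx → {p : Pol} → STy [] p → Type
  /-- Forwarding `a → b`. -/
  | fwd {Ψ : FCtx} {p : Pol} {A : STy [] p} : Proc Ψ (.cons A .nil) A
  /-- Parallel composition `a ← P; Q`. -/
  | cut {Ψ : FCtx} {Δ Δ₁ Δ₂ : LCtx} {p q : Pol} {A : STy [] p} {C : STy [] q}
      (s : Split Δ Δ₁ Δ₂) (P : Proc Ψ Δ₁ A) (Q : Proc Ψ (.cons A Δ₂) C) : Proc Ψ Δ C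
  /-- `close a`, providing `a : 1`. -/
  | close {Ψ : FCtx} : Proc Ψ .nil STy.one
  /-- `wait a; P`, using `a : 1`. -/
  | wait {Ψ : FCtx} {Δ Δ' : LCtx} {p : Pol} {C : STy [] p} (a : Pick STy.one Δ Δ')
      (P : Proc Ψ Δ' C) : Proc Ψ Δ C
  /-- `send a shift; P`, providing `a : ↓A`. -/
  | dshiftR {Ψ : FCtx} {Δ : LCtx} {A : STy [] .neg} (P : Proc Ψ Δ A) : Proc Ψ Δ (.dshift A)
  /-- `shift ← recv a; P`, using `a : ↓A`. -/
  | dshiftL {Ψ : FCtx} {Δ Δ' : LCtx} {p : Pol} {A : STy [] .neg} {C : STy [] p}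
      (a : Pick (.dshift A) Δ Δ') (P : Proc Ψ (.cons A Δ') C) : Proc Ψ Δ C
  /-- `shift ← recv a; P`, providing `a : ↑A`. -/
  | ushiftR {Ψ : FCtx} {Δ : LCtx} {A : STy [] .pos} (P : Proc Ψ Δ A) : Proc Ψ Δ (.ushift A)
  /-- `send a shift; P`, using `a : ↑A`. -/
  | ushiftL {Ψ : FCtx} {Δ Δ' : LCtx} {p : Pol} {A : STy [] .pos} {C : STy [] p}
      (a : Pick (.ushift A) Δ Δ') (P : Proc Ψ (.cons A Δ') C) : Proc Ψ Δ C
  /-- `a.k; P`, providing `a : ⊕{l : A l}`. -/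
  | plusR {Ψ : FCtx} {Δ : LCtx} {L : Finset Label} {A : L → STy [] .pos} (k : L)
      (P : Proc Ψ Δ (A k)) : Proc Ψ Δ (.plus L A)
  /-- `case a {l ⇒ P l}`, using `a : ⊕{l : A l}`. -/
  | plusL {Ψ : FCtx} {Δ Δ' : LCtx} {p : Pol} {L : Finset Label} {A : L → STy [] .pos}
      {C : STy [] p} (a : Pick (.plus L A) Δ Δ') (P : ∀ l, Proc Ψ (.cons (A l) Δ') C) : Proc Ψ Δ C
  /-- `case a {l ⇒ P l}`, providing `a : &{l : A l}`. -/
  | ampR {Ψ : FCtx} {Δ : LCtx} {L : Finset Label} {A : L → STy [] .neg}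
      (P : ∀ l, Proc Ψ Δ (A l)) : Proc Ψ Δ (.amp L A)
  /-- `a.k; P`, using `a : &{l : A l}`. -/
  | ampL {Ψ : FCtx} {Δ Δ' : LCtx} {p : Pol} {L : Finset Label} {A : L → STy [] .neg}
      {C : STy [] p} (a : Pick (.amp L A) Δ Δ') (k : L) (P : Proc Ψ (.cons (A k) Δ') C) :
      Proc Ψ Δ C
  /-- `send a b; P`, providing `a : B ⊗ A` and using `b : B`. -/
  | tensorR {Ψ : FCtx} {Δ Δ' : LCtx} {B A : STy [] .pos} (b : Pick B Δ Δ') (P : Proc Ψ Δ' A) :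
      Proc Ψ Δ (.tensor B A)
  /-- `b ← recv a; P`, using `a : B ⊗ A`. -/
  | tensorL {Ψ : FCtx} {Δ Δ' : LCtx} {p : Pol} {B A : STy [] .pos} {C : STy [] p}
      (a : Pick (.tensor B A) Δ Δ') (P : Proc Ψ (.cons A (.cons B Δ')) C) : Proc Ψ Δ C
  /-- `b ← recv a; P`, providing `a : B ⊸ A`. -/
  | lollyR {Ψ : FCtx} {Δ : LCtx} {B : STy [] .pos} {A : STy [] .neg} (P : Proc Ψ (.cons B Δ) A) :
      Proc Ψ Δ (.lolly B A)
  /-- `send a b; P`, using `a : B ⊸ A` and `b : B`. -/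
  | lollyL {Ψ : FCtx} {Δ Δ' Δ'' : LCtx} {p : Pol} {B : STy [] .pos} {A : STy [] .neg} {C : STy [] p}
      (b : Pick B Δ Δ') (a : Pick (.lolly B A) Δ' Δ'') (P : Proc Ψ (.cons A Δ'') C) : Proc Ψ Δ C
  /-- `_ ← output a M; P`, providing `a : τ ∧ A`. -/
  | andR {Ψ : FCtx} {Δ : LCtx} {τ : FTy} {A : STy [] .pos} (M : Tm Ψ τ) (P : Proc Ψ Δ A) :
      Proc Ψ Δ (.and τ A)
  /-- `x ← input a; P`, using `a : τ ∧ A`. -/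
  | andL {Ψ : FCtx} {Δ Δ' : LCtx} {p : Pol} {τ : FTy} {A : STy [] .pos} {C : STy [] p}
      (a : Pick (.and τ A) Δ Δ') (P : Proc (τ :: Ψ) (.cons A Δ') C) : Proc Ψ Δ C
  /-- `x ← input a; P`, providing `a : τ ⊃ A`. -/
  | impR {Ψ : FCtx} {Δ : LCtx} {τ : FTy} {A : STy [] .neg} (P : Proc (τ :: Ψ) Δ A) :
      Proc Ψ Δ (.imp τ A)
  /-- `_ ← output a M; P`, using `a : τ ⊃ A`. -/
  | impL {Ψ : FCtx} {Δ Δ' : LCtx} {p : Pol} {τ : FTy} {A : STy [] .neg} {C : STy [] p}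
      (a : Pick (.imp τ A) Δ Δ') (M : Tm Ψ τ) (P : Proc Ψ (.cons A Δ') C) : Proc Ψ Δ C
  /-- `send a unfold; P`, providing `a : ρα.A` for positive `ρα.A`. -/
  | muPosR {Ψ : FCtx} {Δ : LCtx} {A : STy [.pos] .pos} (P : Proc Ψ Δ A.unfolding) :
      Proc Ψ Δ (.mu A)
  /-- `unfold ← recv a; P`, using `a : ρα.A` for positive `ρα.A`. -/
  | muPosL {Ψ : FCtx} {Δ Δ' : LCtx} {p : Pol} {A : STy [.pos] .pos} {C : STy [] p}
      (a : Pick (.mu A) Δ Δ') (P : Proc Ψ (.cons A.unfolding Δ') C) : Proc Ψ Δ C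
  /-- `unfold ← recv a; P`, providing `a : ρα.A` for negative `ρα.A`. -/
  | muNegR {Ψ : FCtx} {Δ : LCtx} {A : STy [.neg] .neg} (P : Proc Ψ Δ A.unfolding) :
      Proc Ψ Δ (.mu A)
  /-- `send a unfold; P`, using `a : ρα.A` for negative `ρα.A`. -/
  | muNegL {Ψ : FCtx} {Δ Δ' : LCtx} {p : Pol} {A : STy [.neg] .neg} {C : STy [] p}
      (a : Pick (.mu A) Δ Δ') (P : Proc Ψ (.cons A.unfolding Δ') C) : Proc Ψ Δ C
  /-- `a ← {M} ← a₁, …, aₙ`, running the process quoted by `M`. -/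
  | spawn {Ψ : FCtx} {Δ Γ : LCtx} {p : Pol} {A : STy [] p} (M : Tm Ψ (.proc A Γ))
      (as : Args Δ Γ) : Proc Ψ Δ A

end

/-! ### Substitution of functional terms -/

/-- Extension of a renaming of variables under a binder. -/
def Var.extend {Ψ Φ : FCtx} {σ : FTy} (ρ : ∀ τ, Var Ψ τ → Var Φ τ) :
    ∀ τ, Var (σ :: Ψ) τ → Var (σ :: Φ) τ
  | _, .here => .here
  | τ, .there x => .there (ρ τ x)

mutual

/-- Renaming of variables in functional terms. -/
def Tm.rename : {Ψ Φ : FCtx} → {τ : FTy} → (∀ τ, Var Ψ τ → Var Φ τ) → Tm Ψ τ → Tm Φ τ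
  | _, _, τ, ρ, .var x => .var (ρ τ x)
  | _, _, _, ρ, .fix M => .fix (M.rename (Var.extend ρ))
  | _, _, _, ρ, .lam M => .lam (M.rename (Var.extend ρ))
  | _, _, _, ρ, .app M N => .app (M.rename ρ) (N.rename ρ)
  | _, _, _, ρ, .quote P => .quote (P.rename ρ)

/-- Renaming of variables in processes. -/
def Proc.rename : {Ψ Φ : FCtx} → {Δ : LCtx} → {p : Pol} → {C : STy [] p} →
    (∀ τ, Var Ψ τ → Var Φ τ) → Proc Ψ Δ C → Proc Φ Δ C
  | _, _, _, _, _, _, .fwd => .fwd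
  | _, _, _, _, _, ρ, .cut s P Q => .cut s (P.rename ρ) (Q.rename ρ)
  | _, _, _, _, _, _, .close => .close
  | _, _, _, _, _, ρ, .wait a P => .wait a (P.rename ρ)
  | _, _, _, _, _, ρ, .dshiftR P => .dshiftR (P.rename ρ)
  | _, _, _, _, _, ρ, .dshiftL a P => .dshiftL a (P.rename ρ)
  | _, _, _, _, _, ρ, .ushiftR P => .ushiftR (P.rename ρ)
  | _, _, _, _, _, ρ, .ushiftL a P => .ushiftL a (P.rename ρ)
  | _, _, _, _, _, ρ, .plusR k P => .plusR k (P.rename ρ)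
  | _, _, _, _, _, ρ, .plusL a P => .plusL a fun l => (P l).rename ρ
  | _, _, _, _, _, ρ, .ampR P => .ampR fun l => (P l).rename ρ
  | _, _, _, _, _, ρ, .ampL a k P => .ampL a k (P.rename ρ)
  | _, _, _, _, _, ρ, .tensorR b P => .tensorR b (P.rename ρ)
  | _, _, _, _, _, ρ, .tensorL a P => .tensorL a (P.rename ρ)
  | _, _, _, _, _, ρ, .lollyR P => .lollyR (P.rename ρ)
  | _, _, _, _, _, ρ, .lollyL b a P => .lollyL b a (P.rename ρ)
  | _, _, _, _, _, ρ, .andR M P => .andR (M.rename ρ) (P.rename ρ)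
  | _, _, _, _, _, ρ, .andL a P => .andL a (P.rename (Var.extend ρ))
  | _, _, _, _, _, ρ, .impR P => .impR (P.rename (Var.extend ρ))
  | _, _, _, _, _, ρ, .impL a M P => .impL a (M.rename ρ) (P.rename ρ)
  | _, _, _, _, _, ρ, .muPosR P => .muPosR (P.rename ρ)
  | _, _, _, _, _, ρ, .muPosL a P => .muPosL a (P.rename ρ)
  | _, _, _, _, _, ρ, .muNegR P => .muNegR (P.rename ρ)
  | _, _, _, _, _, ρ, .muNegL a P => .muNegL a (P.rename ρ)
  | _, _, _, _, _, ρ, .spawn M as => .spawn (M.rename ρ) as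

end

/-- Extension of a substitution under a binder. -/
def Tm.extend {Ψ Φ : FCtx} {σ : FTy} (s : ∀ τ, Var Ψ τ → Tm Φ τ) :
    ∀ τ, Var (σ :: Ψ) τ → Tm (σ :: Φ) τ
  | _, .here => .var .here
  | τ, .there x => (s τ x).rename fun _ => .there

mutual

/-- The simultaneous substitution `[M₁, …, Mₙ/x₁, …, xₙ]N` in a functional term. -/
def Tm.subst : {Ψ Φ : FCtx} → {τ : FTy} → (∀ τ, Var Ψ τ → Tm Φ τ) → Tm Ψ τ → Tm Φ τ
  | _, _, τ, s, .var x => s τ x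
  | _, _, _, s, .fix M => .fix (M.subst (Tm.extend s))
  | _, _, _, s, .lam M => .lam (M.subst (Tm.extend s))
  | _, _, _, s, .app M N => .app (M.subst s) (N.subst s)
  | _, _, _, s, .quote P => .quote (P.subst s)

/-- The simultaneous substitution `[M₁, …, Mₙ/x₁, …, xₙ]P` in a process. -/
def Proc.subst : {Ψ Φ : FCtx} → {Δ : LCtx} → {p : Pol} → {C : STy [] p} →
    (∀ τ, Var Ψ τ → Tm Φ τ) → Proc Ψ Δ C → Proc Φ Δ C
  | _, _, _, _, _, _, .fwd => .fwd
  | _, _, _, _, _, s, .cut t P Q => .cut t (P.subst s) (Q.subst s)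
  | _, _, _, _, _, _, .close => .close
  | _, _, _, _, _, s, .wait a P => .wait a (P.subst s)
  | _, _, _, _, _, s, .dshiftR P => .dshiftR (P.subst s)
  | _, _, _, _, _, s, .dshiftL a P => .dshiftL a (P.subst s)
  | _, _, _, _, _, s, .ushiftR P => .ushiftR (P.subst s)
  | _, _, _, _, _, s, .ushiftL a P => .ushiftL a (P.subst s)
  | _, _, _, _, _, s, .plusR k P => .plusR k (P.subst s)
  | _, _, _, _, _, s, .plusL a P => .plusL a fun l => (P l).subst s
  | _, _, _, _, _, s, .ampR P => .ampR fun l => (P l).subst s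
  | _, _, _, _, _, s, .ampL a k P => .ampL a k (P.subst s)
  | _, _, _, _, _, s, .tensorR b P => .tensorR b (P.subst s)
  | _, _, _, _, _, s, .tensorL a P => .tensorL a (P.subst s)
  | _, _, _, _, _, s, .lollyR P => .lollyR (P.subst s)
  | _, _, _, _, _, s, .lollyL b a P => .lollyL b a (P.subst s)
  | _, _, _, _, _, s, .andR M P => .andR (M.subst s) (P.subst s)
  | _, _, _, _, _, s, .andL a P => .andL a (P.subst (Tm.extend s))
  | _, _, _, _, _, s, .impR P => .impR (P.subst (Tm.extend s))
  | _, _, _, _, _, s, .impL a M P => .impL a (M.subst s) (P.subst s)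
  | _, _, _, _, _, s, .muPosR P => .muPosR (P.subst s)
  | _, _, _, _, _, s, .muPosL a P => .muPosL a (P.subst s)
  | _, _, _, _, _, s, .muNegR P => .muNegR (P.subst s)
  | _, _, _, _, _, s, .muNegL a P => .muNegL a (P.subst s)
  | _, _, _, _, _, s, .spawn M as => .spawn (M.subst s) as

end

/-! ### Operations on continuous functions that interpret the rules

In this section `U` stands for `⟦Ψ⟧`; `Dn`, `Dp` for the aspects `⟦Δ⟧^-`, `⟦Δ⟧^+` of the used channels
that are not principal in the rule; `An`, `Ap` and `Bn`, `Bp` for the aspects of the principal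
channels; and `Cn`, `Cp` for the aspects of the provided channel, if it is not principal. -/

namespace Sem

/-- The dcpo of continuous functions `⟦Ψ⟧ → [⟦Δ⟧^+ × ⟦C⟧^- → ⟦Δ⟧^- × ⟦C⟧^+]`. -/
abbrev Beh (U Dn Dp Cn Cp : Type) [CompletePartialOrder U] [CompletePartialOrder Dn]
    [CompletePartialOrder Dp] [CompletePartialOrder Cn] [CompletePartialOrder Cp] : Type :=
  CMap U (CMap (Dp × Cn) (Dn × Cp))

variable {U An Ap Bn Bp Cn Cp Dn Dp En Ep Fn Fp T : Type} [CompletePartialOrder U]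
  [CompletePartialOrder An] [CompletePartialOrder Ap] [CompletePartialOrder Bn]
  [CompletePartialOrder Bp] [CompletePartialOrder Cn] [CompletePartialOrder Cp]
  [CompletePartialOrder Dn] [CompletePartialOrder Dp] [CompletePartialOrder En]
  [CompletePartialOrder Ep] [CompletePartialOrder Fn] [CompletePartialOrder Fp]
  [CompletePartialOrder T]

/-- Reordering of the used channels along isomorphisms. -/
noncomputable def exch (en : Dn ≃o En) (ep : Dp ≃o Ep) (P : Beh U En Ep Cn Cp) :
    Beh U Dn Dp Cn Cp :=
  CMap.lam (fun u x =>
    let y := P u (ep x.1, x.2)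
    (en.symm y.1, y.2)) (by fun_prop)

noncomputable def fwd : Beh U (An × PUnit) (Ap × PUnit) An Ap :=
  CMap.lam (fun _ x => ((x.2, ⟨⟩), x.1.1)) (by fun_prop)

/-- The trace of the product of `P u` and `Q u` over the aspects `An × Ap` of the cut channel. -/
noncomputable def cut (P : Beh U Dn Dp An Ap) (Q : Beh U (An × En) (Ap × Ep) Cn Cp) :
    Beh U (Dn × En) (Dp × Ep) Cn Cp :=
  CMap.comp ⟨trace, cont_trace⟩ (CMap.lam (fun u (z : ((Dp × Ep) × Cn) × (An × Ap)) =>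
    let y := P u (z.1.1.1, z.2.1)
    let w := Q u ((z.2.2, z.1.1.2), z.1.2)
    (((y.1, w.1.2), w.2), (w.1.1, y.2))) (by fun_prop))

noncomputable def close : Beh U PUnit PUnit PUnit (WithBot PUnit) :=
  CMap.lam (fun _ _ => (⟨⟩, up ⟨⟩)) (by fun_prop)

noncomputable def wait (P : Beh U Dn Dp Cn Cp) : Beh U (PUnit × Dn) (WithBot PUnit × Dp) Cn Cp :=
  CMap.lam (fun u x =>
    let y := P u (x.1.2, x.2)
    guard x.1.1 ((⟨⟩, y.1), y.2)) (by fun_prop)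

/-- Sending a shift on the provided channel. -/
noncomputable def sendShiftR (P : Beh U Dn Dp An Ap) : Beh U Dn Dp An (WithBot Ap) :=
  CMap.lam (fun u x =>
    let y := P u x
    (y.1, up y.2)) (by fun_prop)

/-- Receiving a shift on a used channel. -/
noncomputable def recvShiftL (P : Beh U (An × Dn) (Ap × Dp) Cn Cp) :
    Beh U (An × Dn) (WithBot Ap × Dp) Cn Cp :=
  CMap.lam (fun u x => guard x.1.1 (P u ((down x.1.1, x.1.2), x.2))) (by fun_prop)

/-- Receiving a shift on the provided channel. -/
noncomputable def recvShiftR (P : Beh U Dn Dp An Ap) : Beh U Dn Dp (WithBot An) Ap :=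
  CMap.lam (fun u x => guard x.2 (P u (x.1, down x.2))) (by fun_prop)

/-- Sending a shift on a used channel. -/
noncomputable def sendShiftL (P : Beh U (An × Dn) (Ap × Dp) Cn Cp) :
    Beh U (WithBot An × Dn) (Ap × Dp) Cn Cp :=
  CMap.lam (fun u x =>
    let y := P u x
    ((up y.1.1, y.1.2), y.2)) (by fun_prop)

section choice
variable {ι : Type} {Gn Gp : ι → Type} [∀ l, CompletePartialOrder (Gn l)]
  [∀ l, CompletePartialOrder (Gp l)]

/-- Sending the label `k` on the provided channel. -/
noncomputable def sendLabelR (k : ι) (P : Beh U Dn Dp (Gn k) (Gp k)) :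
    Beh U Dn Dp (∀ l, Gn l) (WithBot (Σ l, Gp l)) :=
  CMap.lam (fun u x =>
    let y := P u (x.1, x.2 k)
    (y.1, inj k y.2)) (by fun_prop)

/-- Receiving a label on a used channel. -/
noncomputable def caseL (P : ∀ k, Beh U (Gn k × Dn) (Gp k × Dp) Cn Cp) :
    Beh U ((∀ l, Gn l) × Dn) (WithBot (Σ l, Gp l) × Dp) Cn Cp :=
  CMap.lam (fun u x => caseOf x.1.1 fun k a =>
    let y := P k u ((a, x.1.2), x.2)
    ((single k y.1.1, y.1.2), y.2)) (by fun_prop)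

/-- Receiving a label on the provided channel. -/
noncomputable def caseR (P : ∀ k, Beh U Dn Dp (Gn k) (Gp k)) :
    Beh U Dn Dp (WithBot (Σ l, Gn l)) (∀ l, Gp l) :=
  CMap.lam (fun u x => caseOf x.2 fun k a =>
    let y := P k u (x.1, a)
    (y.1, single k y.2)) (by fun_prop)

/-- Sending the label `k` on a used channel. -/
noncomputable def sendLabelL (k : ι) (P : Beh U (Gn k × Dn) (Gp k × Dp) Cn Cp) :
    Beh U (WithBot (Σ l, Gn l) × Dn) ((∀ l, Gp l) × Dp) Cn Cp :=
  CMap.lam (fun u x =>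
    let y := P u ((x.1.1 k, x.1.2), x.2)
    ((inj k y.1.1, y.1.2), y.2)) (by fun_prop)

end choice

noncomputable def tensorR (P : Beh U Dn Dp An Ap) :
    Beh U (Bn × Dn) (Bp × Dp) (Bn × An) (WithBot (Bp × Ap)) :=
  CMap.lam (fun u x =>
    let y := P u (x.1.2, x.2.2)
    ((x.2.1, y.1), up (x.1.1, y.2))) (by fun_prop)

noncomputable def tensorL (P : Beh U (An × Bn × Dn) (Ap × Bp × Dp) Cn Cp) :
    Beh U ((Bn × An) × Dn) (WithBot (Bp × Ap) × Dp) Cn Cp :=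
  CMap.lam (fun u x =>
    let y := P u (((down x.1.1).2, (down x.1.1).1, x.1.2), x.2)
    guard x.1.1 (((y.1.2.1, y.1.1), y.1.2.2), y.2)) (by fun_prop)

noncomputable def lollyR (P : Beh U (Bn × Dn) (Bp × Dp) An Ap) :
    Beh U Dn Dp (WithBot (Bp × An)) (Bn × Ap) :=
  CMap.lam (fun u x =>
    let y := P u (((down x.2).1, x.1), (down x.2).2)
    guard x.2 (y.1.2, (y.1.1, y.2))) (by fun_prop)

noncomputable def lollyL (P : Beh U (An × Dn) (Ap × Dp) Cn Cp) :
    Beh U (Bn × WithBot (Bp × An) × Dn) (Bp × (Bn × Ap) × Dp) Cn Cp :=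
  CMap.lam (fun u x =>
    let y := P u ((x.1.2.1.2, x.1.2.2), x.2)
    ((x.1.2.1.1, up (x.1.1, y.1.1), y.1.2), y.2)) (by fun_prop)

noncomputable def andR (M : CMap U T) (P : Beh U Dn Dp An Ap) :
    Beh U Dn Dp An (WithBot (T × Ap)) :=
  CMap.lam (fun u x =>
    let y := P u x
    guard (M u) (y.1, up (M u, y.2))) (by fun_prop)

noncomputable def andL (P : Beh (T × U) (An × Dn) (Ap × Dp) Cn Cp) :
    Beh U (An × Dn) (WithBot (T × Ap) × Dp) Cn Cp :=
  CMap.lam (fun u x =>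
    guard x.1.1 (P ((down x.1.1).1, u) (((down x.1.1).2, x.1.2), x.2))) (by fun_prop)

noncomputable def impR (P : Beh (T × U) Dn Dp An Ap) : Beh U Dn Dp (WithBot (T × An)) Ap :=
  CMap.lam (fun u x => guard x.2 (P ((down x.2).1, u) (x.1, (down x.2).2))) (by fun_prop)

noncomputable def impL (M : CMap U T) (P : Beh U (An × Dn) (Ap × Dp) Cn Cp) :
    Beh U (WithBot (T × An) × Dn) (Ap × Dp) Cn Cp :=
  CMap.lam (fun u x =>
    let y := P u x
    guard (M u) ((up (M u, y.1.1), y.1.2), y.2)) (by fun_prop)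

/-- Unfolding on the provided channel: `(id × Fold) ∘ P u ∘ (id × Unfold)`. -/
noncomputable def muR (unfold : SMap Bn An) (fold : SMap Ap Bp) (P : Beh U Dn Dp An Ap) :
    Beh U Dn Dp Bn Bp :=
  CMap.lam (fun u x =>
    let y := P u (x.1, unfold x.2)
    (y.1, fold y.2)) (by fun_prop)

/-- Unfolding on a used channel: `(Fold × id) ∘ P u ∘ (Unfold × id)`. -/
noncomputable def muL (unfold : SMap Bp Ap) (fold : SMap An Bn)
    (P : Beh U (An × Dn) (Ap × Dp) Cn Cp) : Beh U (Bn × Dn) (Bp × Dp) Cn Cp :=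
  CMap.lam (fun u x =>
    let y := P u ((unfold x.1.1, x.1.2), x.2)
    ((fold y.1.1, y.1.2), y.2)) (by fun_prop)

noncomputable def fix (M : CMap (T × U) T) : CMap U T := sfix ⟨fun x => M (x.2, x.1), by fun_prop⟩

variable {S : Type} [CompletePartialOrder S]

noncomputable def lam (M : CMap (T × U) S) : CMap U (SMap T S) :=
  ⟨fun u => strictfn (CMap.lam (fun u v => M (v, u)) (by fun_prop) u), by fun_prop⟩

noncomputable def app (M : CMap U (SMap T S)) (N : CMap U T) : CMap U S :=
  ⟨fun u => (M u) (N u), by fun_prop⟩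

noncomputable def quote (P : Beh U Dn Dp Cn Cp) : CMap U (WithBot (CMap (Dp × Cn) (Dn × Cp))) :=
  ⟨fun u => up (P u), by fun_prop⟩

noncomputable def spawn (M : CMap U (WithBot (CMap (Dp × Cn) (Dn × Cp)))) : Beh U Dn Dp Cn Cp :=
  ⟨fun u => down (M u), by fun_prop⟩

end Sem

/-! ### Denotations of functional terms and processes -/

/-- `⟦Ψ⟧ = ⟦τ₁⟧ × ⋯ × ⟦τₙ⟧`. -/
noncomputable def env : FCtx → Dom
  | [] => Dom.unit
  | τ :: Ψ => Dom.prod τ.den (env Ψ)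

/-- The projection `π_x : ⟦Ψ⟧ → ⟦τ⟧`. -/
noncomputable def Var.den : {Ψ : FCtx} → {τ : FTy} → Var Ψ τ → CMap (env Ψ) τ.den
  | _, _, .here => ⟨fun u => u.1, by fun_prop⟩
  | _, _, .there x => ⟨fun u => x.den u.2, by fun_prop⟩

/-- The order isomorphism `A × D ≃ A × E` induced by `D ≃ E`. -/
def consIso (A : Type) {D E : Type} [Preorder A] [Preorder D] [Preorder E] (e : D ≃o E) :
    A × D ≃o A × E where
  toEquiv := (Equiv.refl A).prodCongr e.toEquiv
  map_rel_iff' := by simp [Prod.le_def]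

/-- The order isomorphism `A × (B × D) ≃ B × (A × D)`. -/
def swapIso (A B D : Type) [Preorder A] [Preorder B] [Preorder D] : A × (B × D) ≃o B × (A × D) where
  toFun x := (x.2.1, x.1, x.2.2)
  invFun x := (x.2.1, x.1, x.2.2)
  left_inv _ := rfl
  right_inv _ := rfl
  map_rel_iff' := by simp [Prod.le_def]; tauto

/-- `⟦Δ⟧^q ≃ ⟦A⟧^q × ⟦Δ'⟧^q` for a channel `a : A` in `Δ` that leaves `Δ'`. -/
noncomputable def Pick.iso (q : Pol) : {p : Pol} → {A : STy [] p} → {Δ Δ' : LCtx} → Pick A Δ Δ' →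
    (Δ.den q ≃o A.aspect q × Δ'.den q)
  | _, _, _, _, .here => OrderIso.refl _
  | _, _, _, _, .there a => (consIso _ (a.iso q)).trans (swapIso _ _ _)

/-- `⟦Δ⟧^q ≃ ⟦Δ₁⟧^q × ⟦Δ₂⟧^q` for a partition of `Δ` into `Δ₁` and `Δ₂`. -/
noncomputable def Split.iso (q : Pol) : {Δ Δ₁ Δ₂ : LCtx} → Split Δ Δ₁ Δ₂ →
    (Δ.den q ≃o Δ₁.den q × Δ₂.den q)
  | _, _, _, .nil =>
    { toFun := fun _ => (PUnit.unit, PUnit.unit)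
      invFun := fun _ => PUnit.unit
      left_inv := fun _ => rfl
      right_inv := fun _ => rfl
      map_rel_iff' := iff_of_true le_rfl le_rfl }
  | _, _, _, .left s => (consIso _ (s.iso q)).trans (OrderIso.prodAssoc _ _ _).symm
  | _, _, _, .right s => (consIso _ (s.iso q)).trans (swapIso _ _ _)

/-- `⟦Δ⟧^q ≃ ⟦Γ⟧^q` for an enumeration of the channels in `Δ` of type `Γ`. -/
noncomputable def Args.iso (q : Pol) : {Δ Γ : LCtx} → Args Δ Γ → (Δ.den q ≃o Γ.den q)
  | _, _, .nil => OrderIso.refl _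
  | _, _, .cons a as => (a.iso q).trans (consIso _ (as.iso q))

mutual

/-- The denotation `⟦Ψ ⊢ M : τ⟧ : ⟦Ψ⟧ → ⟦τ⟧`. -/
noncomputable def Tm.den : {Ψ : FCtx} → {τ : FTy} → Tm Ψ τ → CMap (env Ψ) τ.den
  | _, _, .var x => x.den
  | _, _, .fix M => Sem.fix M.den
  | _, _, .lam M => Sem.lam M.den
  | _, _, .app M N => Sem.app M.den N.den
  | _, _, .quote P => Sem.quote P.den

/-- The denotation `⟦Ψ ; Δ ⊢ P :: c : C⟧ : ⟦Ψ⟧ → [⟦Δ⟧^+ × ⟦C⟧^- → ⟦Δ⟧^- × ⟦C⟧^+]`. -/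
noncomputable def Proc.den : {Ψ : FCtx} → {Δ : LCtx} → {p : Pol} → {C : STy [] p} → Proc Ψ Δ C →
    Sem.Beh (env Ψ) (Δ.den .neg) (Δ.den .pos) (C.aspect .neg) (C.aspect .pos)
  | _, _, _, _, .fwd => Sem.fwd
  | _, _, _, _, .cut s P Q => Sem.exch (s.iso .neg) (s.iso .pos) (Sem.cut P.den Q.den)
  | _, _, _, _, .close => Sem.close
  | _, _, _, _, .wait a P => Sem.exch (a.iso .neg) (a.iso .pos) (Sem.wait P.den)
  | _, _, _, _, .dshiftR P => Sem.sendShiftR P.den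
  | _, _, _, _, .dshiftL a P => Sem.exch (a.iso .neg) (a.iso .pos) (Sem.recvShiftL P.den)
  | _, _, _, _, .ushiftR P => Sem.recvShiftR P.den
  | _, _, _, _, .ushiftL a P => Sem.exch (a.iso .neg) (a.iso .pos) (Sem.sendShiftL P.den)
  | _, _, _, _, .plusR k P => Sem.sendLabelR k P.den
  | _, _, _, _, .plusL a P =>
    Sem.exch (a.iso .neg) (a.iso .pos) (Sem.caseL fun l => (P l).den)
  | _, _, _, _, .ampR P => Sem.caseR fun l => (P l).den
  | _, _, _, _, .ampL a k P => Sem.exch (a.iso .neg) (a.iso .pos) (Sem.sendLabelL k P.den)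
  | _, _, _, _, .tensorR b P => Sem.exch (b.iso .neg) (b.iso .pos) (Sem.tensorR P.den)
  | _, _, _, _, .tensorL a P => Sem.exch (a.iso .neg) (a.iso .pos) (Sem.tensorL P.den)
  | _, _, _, _, .lollyR P => Sem.lollyR P.den
  | _, _, _, _, .lollyL b a P =>
    Sem.exch ((b.iso .neg).trans (consIso _ (a.iso .neg)))
      ((b.iso .pos).trans (consIso _ (a.iso .pos))) (Sem.lollyL P.den)
  | _, _, _, _, .andR M P => Sem.andR M.den P.den
  | _, _, _, _, .andL a P => Sem.exch (a.iso .neg) (a.iso .pos) (Sem.andL P.den)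
  | _, _, _, _, .impR P => Sem.impR P.den
  | _, _, _, _, .impL a M P => Sem.exch (a.iso .neg) (a.iso .pos) (Sem.impL M.den P.den)
  | _, _, _, _, .muPosR (A := A) P => Sem.muR (A.unfold .neg) (A.fold .pos) P.den
  | _, _, _, _, .muPosL (A := A) a P =>
    Sem.exch (a.iso .neg) (a.iso .pos) (Sem.muL (A.unfold .pos) (A.fold .neg) P.den)
  | _, _, _, _, .muNegR (A := A) P => Sem.muR (A.unfold .neg) (A.fold .pos) P.den
  | _, _, _, _, .muNegL (A := A) a P =>
    Sem.exch (a.iso .neg) (a.iso .pos) (Sem.muL (A.unfold .pos) (A.fold .neg) P.den)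
  | _, _, _, _, .spawn M as => Sem.exch (as.iso .neg) (as.iso .pos) (Sem.spawn M.den)

end

/-- The tuple `⟨f₁, …, fₙ⟩ : D → ⟦τ₁⟧ × ⋯ × ⟦τₙ⟧`. -/
noncomputable def tuple {D : Dom} : {Ψ : FCtx} → (∀ τ, Var Ψ τ → CMap D τ.den) → CMap D (env Ψ)
  | [], _ => ⟨fun _ => PUnit.unit, ScottContinuous.const _⟩
  | _ :: _, f =>
    ⟨fun u => (f _ .here u, tuple (fun τ x => f τ (.there x)) u), by fun_prop⟩


end SILL

namespace SILL

theorem Var.den_comp_tuple {D : Dom} {Ψ : FCtx} (f : ∀ τ, Var Ψ τ → CMap D τ.den) {τ : FTy}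
    (x : Var Ψ τ) : x.den.comp (tuple f) = f τ x := by
  induction x with
  | here => rfl
  | there x ih => exact ih fun τ x => f τ (.there x)

theorem tuple_comp {D E : Dom} (g : CMap D E) {Ψ : FCtx} (f : ∀ τ, Var Ψ τ → CMap E τ.den) :
    (tuple fun τ x => (f τ x).comp g) = (tuple f).comp g := by
  induction Ψ with
  | nil => rfl
  | cons τ Ψ ih =>
    refine CMap.ext' fun u => ?_
    exact congrArg (Prod.mk _) (DFunLike.congr_fun (ih fun τ x => f τ (.there x)) u)

theorem tuple_var (Ψ : FCtx) (u : env Ψ) : tuple (fun _ (x : Var Ψ _) => x.den) u = u := by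
  induction Ψ with
  | nil => rfl
  | cons τ Ψ ih =>
    have h := DFunLike.congr_fun
      (tuple_comp (⟨fun u => u.2, by fun_prop⟩ : CMap (env (τ :: Ψ)) (env Ψ))
        fun _ (x : Var Ψ _) => x.den) u
    exact congrArg (Prod.mk _) (h.trans (ih u.2))

/-- The function `id × f`. -/
def CMap.under (T : Type) {α β : Type} [CompletePartialOrder T] [CompletePartialOrder α]
    [CompletePartialOrder β] (f : CMap α β) : CMap (T × α) (T × β) :=
  ⟨fun p => (p.1, f p.2), by fun_prop⟩

theorem tuple_extend {D : Dom} {Ψ : FCtx} {σ : FTy} (f : ∀ τ, Var Ψ τ → CMap D τ.den)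
    (g : ∀ τ, Var (σ :: Ψ) τ → CMap (Dom.prod σ.den D) τ.den)
    (hh : g σ .here = ⟨fun p => p.1, by fun_prop⟩)
    (ht : ∀ τ x, g τ (.there x) = (f τ x).comp ⟨fun p => p.2, by fun_prop⟩) :
    tuple g = CMap.under σ.den (tuple f) := by
  refine CMap.ext' fun p => Prod.ext ?_ ?_
  · exact DFunLike.congr_fun hh p
  · have h : (tuple fun τ x => g τ (.there x)) = _ :=
      (congrArg tuple (funext fun τ => funext fun x => ht τ x)).trans
        (tuple_comp (D := Dom.prod σ.den D) (E := D) ⟨fun p => p.2, by fun_prop⟩ f)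
    exact DFunLike.congr_fun h p

theorem tuple_renameExtend {Ψ Φ : FCtx} (σ : FTy) (ρ : ∀ τ, Var Ψ τ → Var Φ τ) :
    (tuple (D := env (σ :: Φ)) fun τ x => (Var.extend ρ τ x).den) =
      CMap.under σ.den (tuple fun τ x => (ρ τ x).den) :=
  tuple_extend _ _ rfl fun _ _ => rfl

mutual

theorem Tm.den_rename {Ψ Φ : FCtx} {τ : FTy} (ρ : ∀ τ, Var Ψ τ → Var Φ τ) (N : Tm Ψ τ) :
    (N.rename ρ).den = N.den.comp (tuple fun σ x => (ρ σ x).den) := by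
  match N with
  | .var x => exact (Var.den_comp_tuple (fun σ x => (ρ σ x).den) x).symm
  | .fix M =>
    simp only [Tm.rename, Tm.den, Tm.den_rename (Var.extend ρ) M, tuple_renameExtend]
    rfl
  | .lam M =>
    simp only [Tm.rename, Tm.den, Tm.den_rename (Var.extend ρ) M, tuple_renameExtend]
    rfl
  | .app M N =>
    simp only [Tm.rename, Tm.den, Tm.den_rename ρ M, Tm.den_rename ρ N]
    rfl
  | .quote P =>
    simp only [Tm.rename, Tm.den, Proc.den_rename ρ P]
    rfl
termination_by structural N

theorem Proc.den_rename {Ψ Φ : FCtx} {Δ : LCtx} {p : Pol} {C : STy [] p}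
    (ρ : ∀ τ, Var Ψ τ → Var Φ τ) (P : Proc Ψ Δ C) :
    (P.rename ρ).den = P.den.comp (tuple fun σ x => (ρ σ x).den) := by
  match P with
  | .fwd => rfl
  | .cut t P Q =>
    simp only [Proc.rename, Proc.den, Proc.den_rename ρ P, Proc.den_rename ρ Q]
    rfl
  | .close => rfl
  | .wait a P =>
    simp only [Proc.rename, Proc.den, Proc.den_rename ρ P]
    rfl
  | .dshiftR P =>
    simp only [Proc.rename, Proc.den, Proc.den_rename ρ P]
    rfl
  | .dshiftL a P =>
    simp only [Proc.rename, Proc.den, Proc.den_rename ρ P]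
    rfl
  | .ushiftR P =>
    simp only [Proc.rename, Proc.den, Proc.den_rename ρ P]
    rfl
  | .ushiftL a P =>
    simp only [Proc.rename, Proc.den, Proc.den_rename ρ P]
    rfl
  | .plusR k P =>
    simp only [Proc.rename, Proc.den, Proc.den_rename ρ P]
    rfl
  | .plusL a P =>
    simp only [Proc.rename, Proc.den, fun l => Proc.den_rename ρ (P l)]
    rfl
  | .ampR P =>
    simp only [Proc.rename, Proc.den, fun l => Proc.den_rename ρ (P l)]
    rfl
  | .ampL a k P =>
    simp only [Proc.rename, Proc.den, Proc.den_rename ρ P]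
    rfl
  | .tensorR b P =>
    simp only [Proc.rename, Proc.den, Proc.den_rename ρ P]
    rfl
  | .tensorL a P =>
    simp only [Proc.rename, Proc.den, Proc.den_rename ρ P]
    rfl
  | .lollyR P =>
    simp only [Proc.rename, Proc.den, Proc.den_rename ρ P]
    rfl
  | .lollyL b a P =>
    simp only [Proc.rename, Proc.den, Proc.den_rename ρ P]
    rfl
  | .andR M P =>
    simp only [Proc.rename, Proc.den, Tm.den_rename ρ M, Proc.den_rename ρ P]
    rfl
  | .andL a P =>
    simp only [Proc.rename, Proc.den, Proc.den_rename (Var.extend ρ) P, tuple_renameExtend]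
    rfl
  | .impR P =>
    simp only [Proc.rename, Proc.den, Proc.den_rename (Var.extend ρ) P, tuple_renameExtend]
    rfl
  | .impL a M P =>
    simp only [Proc.rename, Proc.den, Tm.den_rename ρ M, Proc.den_rename ρ P]
    rfl
  | .muPosR P =>
    simp only [Proc.rename, Proc.den, Proc.den_rename ρ P]
    rfl
  | .muPosL a P =>
    simp only [Proc.rename, Proc.den, Proc.den_rename ρ P]
    rfl
  | .muNegR P =>
    simp only [Proc.rename, Proc.den, Proc.den_rename ρ P]
    rfl
  | .muNegL a P =>
    simp only [Proc.rename, Proc.den, Proc.den_rename ρ P]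
    rfl
  | .spawn M as =>
    simp only [Proc.rename, Proc.den, Tm.den_rename ρ M]
    rfl
termination_by structural P

end

theorem Tm.den_weaken {Φ : FCtx} {τ : FTy} (σ : FTy) (M : Tm Φ τ) :
    (M.rename fun _ => Var.there (σ := σ)).den =
      M.den.comp (⟨fun p => p.2, by fun_prop⟩ : CMap (env (σ :: Φ)) (env Φ)) := by
  rw [Tm.den_rename]
  refine congrArg M.den.comp ?_
  refine (tuple_comp (⟨fun p => p.2, by fun_prop⟩ : CMap (env (σ :: Φ)) (env Φ))
    fun _ (x : Var Φ _) => x.den).trans ?_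
  exact CMap.ext' fun p => tuple_var Φ p.2

theorem tuple_substExtend {Ψ Φ : FCtx} (σ : FTy) (s : ∀ τ, Var Ψ τ → Tm Φ τ) :
    (tuple (D := env (σ :: Φ)) fun τ x => (Tm.extend s τ x).den) =
      CMap.under σ.den (tuple fun τ x => (s τ x).den) :=
  tuple_extend _ _ (by simp only [Tm.extend, Tm.den]; rfl) fun τ x => Tm.den_weaken σ (s τ x)

mutual

theorem Tm.den_subst {Ψ Φ : FCtx} {τ : FTy} (s : ∀ τ, Var Ψ τ → Tm Φ τ) (N : Tm Ψ τ) :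
    (N.subst s).den = N.den.comp (tuple fun σ x => (s σ x).den) := by
  match N with
  | .var x => exact (Var.den_comp_tuple (fun σ x => (s σ x).den) x).symm
  | .fix M =>
    simp only [Tm.subst, Tm.den, Tm.den_subst (Tm.extend s) M, tuple_substExtend]
    rfl
  | .lam M =>
    simp only [Tm.subst, Tm.den, Tm.den_subst (Tm.extend s) M, tuple_substExtend]
    rfl
  | .app M N =>
    simp only [Tm.subst, Tm.den, Tm.den_subst s M, Tm.den_subst s N]
    rfl
  | .quote P =>
    simp only [Tm.subst, Tm.den, Proc.den_subst s P]
    rfl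
termination_by structural N

theorem Proc.den_subst {Ψ Φ : FCtx} {Δ : LCtx} {p : Pol} {C : STy [] p}
    (s : ∀ τ, Var Ψ τ → Tm Φ τ) (P : Proc Ψ Δ C) :
    (P.subst s).den = P.den.comp (tuple fun σ x => (s σ x).den) := by
  match P with
  | .fwd => rfl
  | .cut t P Q =>
    simp only [Proc.subst, Proc.den, Proc.den_subst s P, Proc.den_subst s Q]
    rfl
  | .close => rfl
  | .wait a P =>
    simp only [Proc.subst, Proc.den, Proc.den_subst s P]
    rfl
  | .dshiftR P =>
    simp only [Proc.subst, Proc.den, Proc.den_subst s P]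
    rfl
  | .dshiftL a P =>
    simp only [Proc.subst, Proc.den, Proc.den_subst s P]
    rfl
  | .ushiftR P =>
    simp only [Proc.subst, Proc.den, Proc.den_subst s P]
    rfl
  | .ushiftL a P =>
    simp only [Proc.subst, Proc.den, Proc.den_subst s P]
    rfl
  | .plusR k P =>
    simp only [Proc.subst, Proc.den, Proc.den_subst s P]
    rfl
  | .plusL a P =>
    simp only [Proc.subst, Proc.den, fun l => Proc.den_subst s (P l)]
    rfl
  | .ampR P =>
    simp only [Proc.subst, Proc.den, fun l => Proc.den_subst s (P l)]
    rfl
  | .ampL a k P =>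
    simp only [Proc.subst, Proc.den, Proc.den_subst s P]
    rfl
  | .tensorR b P =>
    simp only [Proc.subst, Proc.den, Proc.den_subst s P]
    rfl
  | .tensorL a P =>
    simp only [Proc.subst, Proc.den, Proc.den_subst s P]
    rfl
  | .lollyR P =>
    simp only [Proc.subst, Proc.den, Proc.den_subst s P]
    rfl
  | .lollyL b a P =>
    simp only [Proc.subst, Proc.den, Proc.den_subst s P]
    rfl
  | .andR M P =>
    simp only [Proc.subst, Proc.den, Tm.den_subst s M, Proc.den_subst s P]
    rfl
  | .andL a P =>
    simp only [Proc.subst, Proc.den, Proc.den_subst (Tm.extend s) P, tuple_substExtend]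
    rfl
  | .impR P =>
    simp only [Proc.subst, Proc.den, Proc.den_subst (Tm.extend s) P, tuple_substExtend]
    rfl
  | .impL a M P =>
    simp only [Proc.subst, Proc.den, Tm.den_subst s M, Proc.den_subst s P]
    rfl
  | .muPosR P =>
    simp only [Proc.subst, Proc.den, Proc.den_subst s P]
    rfl
  | .muPosL a P =>
    simp only [Proc.subst, Proc.den, Proc.den_subst s P]
    rfl
  | .muNegR P =>
    simp only [Proc.subst, Proc.den, Proc.den_subst s P]
    rfl
  | .muNegL a P =>
    simp only [Proc.subst, Proc.den, Proc.den_subst s P]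
    rfl
  | .spawn M as =>
    simp only [Proc.subst, Proc.den, Tm.den_subst s M]
    rfl
termination_by structural P

end

end SILL

theorem mainTheorem10 (Φ Ψ : SILL.FCtx) (M : ∀ τ : SILL.FTy, SILL.Var Ψ τ → SILL.Tm Φ τ) :
    (∀ (τ : SILL.FTy) (N : SILL.Tm Ψ τ),
      (N.subst M).den = N.den.comp (SILL.tuple fun σ x => (M σ x).den)) ∧
    (∀ (Δ : SILL.LCtx) (p : SILL.Pol) (C : SILL.STy [] p) (P : SILL.Proc Ψ Δ C),
      (P.subst M).den = P.den.comp (SILL.tuple fun σ x => (M σ x).den)) :=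
  ⟨fun _ N => N.den_subst M, fun _ _ _ P => P.den_subst M⟩
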